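/- Let $m$ be a positive integer and let $\gamma$ denote Euler's constant. Then $$ \begin{aligned} -\gamma+\sum_{j=1}^{m}\frac1j={}&\frac{\pi}{3}\log m+\frac1{2m}-\frac1{4\pi m^2} +\sum_{\substack{k=1\\k\ne m}}^{\infty}\frac{2k}{(e^{2\pi k}-1)(k^2-m^2)}\\ &+\frac{\pi}{2}\cdot\frac{\log\pi-\log(2m^3)-1}{\sinh^2(\pi m)} -\frac{\pi}{2}\sum_{\substack{k=1\\k\ne m}}^{\infty}\frac{\log|k^4-m^4|}{\sinh^2(\pi k)}\\ &+\frac{1}{2m\,(e^{2\pi m}-1)} +2\pi\sum_{k=1}^{\infty}k\,e^{-2\pi km}\sum_{n=1}^{\infty}\frac{k^2}{n(k^2+n^2)}, \end{aligned} $$ where all the series on the right-hand side converge absolutely. -/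

import Mathlib

namespace HarmonicBose
open Filter Topology Complex
open scoped Real

/-! Write h(z) = 1 / (e^{2πz} - 1), so that `bose n` = h(n) and `boseDeriv n` = h'(n), and consider
the product F(z) = h(z) π² / sin²(πz) in the open first quadrant. There F has two expansions.
Expanding both factors in exponentials gives a double series of terms e^{2π(in - k)z}. Its poles, at
0, at the integers and at the integer multiples of i, give a partial fraction series
(`hasSum_polarTerm`), with no entire remainder. Integrating both termwise produces two
antiderivatives, `expSide` and `polarSide`, which therefore differ by a constant
(`exists_polarSide_sub_expSide_eq`).

The real part of that constant is found by letting z tend to infinity along the diagonal. There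
`expSide` vanishes. In `polarSide` the double poles at the negative integers contribute a digamma
series, asymptotic to log|z| + γ, and everything else is a multiple of log|z| plus o(1). A constant
cannot grow like a logarithm, so the total coefficient of log|z| vanishes and the constant has real
part -γ (`polarSide_re_eq`).

The formula is the boundary value of this identity at z = m, approached vertically as z = m + iy
with y → 0+. Both sides diverge like h'(m) log y. After subtracting this, `polarSide` yields the
harmonic number, the rational sum and the logarithmic sum (`tendsto_polarSide_above`). In `expSide`
the factor e^{2πinm} is 1, so summation over n leaves a geometric series, a logarithmic series and a
convergent remainder (`tendsto_expSide_above`). Exponential decay of h(n), h'(n) and e^{-2πkm}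
justifies the exchanges of limit and sum in which these weights occur; the digamma series is handled
with 1/n² bounds. -/

/-! ### Exponential decay of the coefficients -/

/-- The value at a positive integer of `x ↦ 1 / (exp (2πx) - 1)`. -/
noncomputable def bose (n : ℕ+) : ℝ := 1 / (Real.exp (2 * π * n) - 1)

/-- The derivative at a positive integer of `x ↦ 1 / (exp (2πx) - 1)`. -/
noncomputable def boseDeriv (n : ℕ+) : ℝ := -(π / 2) / Real.sinh (π * n) ^ 2

lemma one_le_pnat (n : ℕ+) : (1 : ℝ) ≤ n := by exact_mod_cast one_le (a := n)

lemma pnat_pos (n : ℕ+) : (0 : ℝ) < n := by exact_mod_cast n.pos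

lemma four_le_exp_two_pi_mul (n : ℕ+) : 4 ≤ Real.exp (2 * π * n) := by
  have h1 : (6 : ℝ) ≤ 2 * π * n := by nlinarith [Real.pi_gt_three, one_le_pnat n]
  linarith [Real.add_one_le_exp (2 * π * n)]

lemma bose_pos (n : ℕ+) : 0 < bose n := by
  have := four_le_exp_two_pi_mul n
  exact div_pos one_pos (by linarith)

lemma bose_le (n : ℕ+) : bose n ≤ 2 * Real.exp (-(2 * π) * n) := by
  have := four_le_exp_two_pi_mul n
  rw [bose, neg_mul, Real.exp_neg, div_le_iff₀ (by linarith), mul_assoc, ← div_eq_inv_mul,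
    ← mul_div_assoc, le_div_iff₀ (by linarith)]
  linarith

lemma inv_sinh_sq_le (n : ℕ+) :
    1 / Real.sinh (π * n) ^ 2 ≤ 16 * Real.exp (-(2 * π) * n) := by
  have h4 := four_le_exp_two_pi_mul n
  have e1 : Real.exp (2 * π * n) = Real.exp (π * n) ^ 2 := by
    rw [← Real.exp_nat_mul]; congr 1; push_cast; ring
  have hp := Real.exp_pos (π * n)
  have h2 : 2 ≤ Real.exp (π * n) := by nlinarith
  have h3 : Real.exp (π * n) / 4 ≤ Real.sinh (π * n) := by
    have h5 : Real.exp (-(π * n)) ≤ Real.exp (π * n) / 2 := by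
      have : Real.exp (-(π * n)) ≤ 1 := Real.exp_le_one_iff.2 (by
        have := pnat_pos n; have := Real.pi_pos; nlinarith [mul_pos Real.pi_pos (pnat_pos n)])
      linarith
    rw [Real.sinh_eq]
    linarith
  have h6 : Real.exp (2 * π * n) / 16 ≤ Real.sinh (π * n) ^ 2 := by
    rw [e1]; nlinarith
  rw [neg_mul, Real.exp_neg, div_le_iff₀ (by linarith)]
  have := inv_pos.2 (Real.exp_pos (2 * π * n))
  calc (1 : ℝ) = 16 * (Real.exp (2 * π * n))⁻¹ * (Real.exp (2 * π * n) / 16) := by field_simp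
    _ ≤ _ := by gcongr

lemma boseDeriv_neg (n : ℕ+) : boseDeriv n < 0 := by
  have h : 0 < Real.sinh (π * n) := Real.sinh_pos_iff.2 (mul_pos Real.pi_pos (pnat_pos n))
  have := Real.pi_pos
  exact div_neg_of_neg_of_pos (by linarith) (by positivity)

lemma abs_boseDeriv_le (n : ℕ+) : |boseDeriv n| ≤ 32 * Real.exp (-(2 * π) * n) := by
  have h := inv_sinh_sq_le n
  have e : |boseDeriv n| = π / 2 * (1 / Real.sinh (π * n) ^ 2) := by
    rw [abs_of_neg (boseDeriv_neg n), boseDeriv]; ring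
  rw [e]
  calc π / 2 * (1 / Real.sinh (π * n) ^ 2) ≤ 2 * (16 * Real.exp (-(2 * π) * n)) := by
        gcongr
        linarith [Real.pi_lt_four]
    _ = _ := by ring

lemma summable_pow_mul_exp (p : ℕ) {r : ℝ} (hr : 0 < r) :
    Summable fun n : ℕ+ => (n : ℝ) ^ p * Real.exp (-r * n) :=
  (Real.summable_pow_mul_exp_neg_nat_mul p hr).comp_injective PNat.coe_injective

lemma summable_pow_mul_bose (p : ℕ) : Summable fun n : ℕ+ => (n : ℝ) ^ p * bose n := by
  refine Summable.of_nonneg_of_le (fun n => mul_nonneg (by positivity) (bose_pos n).le)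
    (fun n => mul_le_mul_of_nonneg_left (bose_le n) (by positivity)) ?_
  exact ((summable_pow_mul_exp p Real.two_pi_pos).mul_left 2).congr fun n => by ring

lemma summable_pow_mul_abs_boseDeriv (p : ℕ) :
    Summable fun n : ℕ+ => (n : ℝ) ^ p * |boseDeriv n| := by
  refine Summable.of_nonneg_of_le (fun n => by positivity)
    (fun n => mul_le_mul_of_nonneg_left (abs_boseDeriv_le n) (by positivity)) ?_
  exact ((summable_pow_mul_exp p Real.two_pi_pos).mul_left 32).congr fun n => by ring

lemma summable_inv_pnat_sq : Summable fun n : ℕ+ => 1 / (n : ℝ) ^ 2 :=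
  (Real.summable_one_div_nat_pow.2 one_lt_two).comp_injective PNat.coe_injective

lemma hasSum_pnat_inv_sq : HasSum (fun n : ℕ+ => 1 / (n : ℝ) ^ 2) (π ^ 2 / 6) := by
  have h := hasSum_zeta_two
  rw [← add_zero (π ^ 2 / 6)] at h
  exact (hasSum_pnat_iff (f := fun n : ℕ => 1 / (n : ℝ) ^ 2)).2 (by simpa using h)

/-! ### Classical expansions: geometric, hyperbolic cotangent, squared cosecant -/

lemma hasSum_exp_neg {z : ℂ} (hz : 0 < z.re) :
    HasSum (fun k : ℕ+ => exp (-(2 * π * k * z))) (1 / (exp (2 * π * z) - 1)) := by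
  have hn : ‖exp (-(2 * π * z))‖ < 1 := by
    rw [norm_exp]
    refine Real.exp_lt_one_iff.2 ?_
    have : (-(2 * π * z)).re = -(2 * π * z.re) := by simp
    rw [this]; have := Real.pi_pos; nlinarith [mul_pos Real.pi_pos hz]
  have h := hasSum_geometric_of_norm_lt_one hn
  have h2 : HasSum (fun k : ℕ+ => exp (-(2 * π * z)) ^ (k : ℕ))
      ((1 - exp (-(2 * π * z)))⁻¹ - 1) := by
    refine (hasSum_pnat_iff (f := fun k : ℕ => exp (-(2 * π * z)) ^ k)).2 ?_
    simpa using h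
  convert! h2 using 1
  · ext k
    rw [← exp_nat_mul]; congr 1; ring
  · rw [exp_neg] at hn ⊢
    have h0 := exp_ne_zero (2 * π * z)
    have h1 : exp (2 * π * z) - 1 ≠ 0 := by
      intro h1
      rw [sub_eq_zero.1 h1] at hn
      simp at hn
    have h3 : 1 - (exp (2 * π * z))⁻¹ = (exp (2 * π * z) - 1) / exp (2 * π * z) := by
      field_simp
    rw [h3]
    field_simp
    ring

/-- The termwise derivative of the geometric series for h. It is used twice: to evaluate the
cosecant series at imaginary integers, and to match the logarithmic singularities of the two sides
at m. -/
lemma hasSum_mul_exp_neg (n : ℕ+) :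
    HasSum (fun k : ℕ+ => (k : ℝ) * Real.exp (-(2 * π * k * n))) (-boseDeriv n / (2 * π)) := by
  have hpn := mul_pos Real.pi_pos (pnat_pos n)
  have hn : ‖Real.exp (-(2 * π * n))‖ < 1 := by
    rw [Real.norm_of_nonneg (Real.exp_pos _).le]
    exact Real.exp_lt_one_iff.2 (by linarith)
  have h := hasSum_coe_mul_geometric_of_norm_lt_one hn
  have h2 : HasSum (fun k : ℕ+ => ((k : ℕ) : ℝ) * Real.exp (-(2 * π * n)) ^ (k : ℕ))
      (Real.exp (-(2 * π * n)) / (1 - Real.exp (-(2 * π * n))) ^ 2) := by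
    refine (hasSum_pnat_iff (f := fun k : ℕ => (k : ℝ) * Real.exp (-(2 * π * n)) ^ k)).2 ?_
    simpa using h
  convert! h2 using 1
  · ext k
    rw [← Real.exp_nat_mul]; congr 2; ring
  · have e1 : Real.exp (-(2 * π * n)) = (Real.exp (π * n) ^ 2)⁻¹ := by
      rw [Real.exp_neg, ← Real.exp_nat_mul]; congr 2; push_cast; ring
    rw [e1, boseDeriv, Real.sinh_eq, Real.exp_neg]
    have hp := Real.exp_pos (π * n)
    have h2 : 1 < Real.exp (π * n) := Real.one_lt_exp_iff.2 hpn
    have h3 : Real.exp (π * n) ^ 2 - 1 ≠ 0 := by nlinarith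
    have h4 := Real.pi_ne_zero
    have h5 : Real.exp (π * n) - (Real.exp (π * n))⁻¹ =
      (Real.exp (π * n) ^ 2 - 1) / Real.exp (π * n) := by field_simp
    have h6 : 1 - (Real.exp (π * n) ^ 2)⁻¹ =
      (Real.exp (π * n) ^ 2 - 1) / Real.exp (π * n) ^ 2 := by field_simp
    rw [h5, h6]
    field_simp

lemma exp_two_pi_sub_one_ne_zero {z : ℂ} (hz : 0 < z.re) : exp (2 * π * z) - 1 ≠ 0 := by
  intro h
  have h1 : ‖exp (2 * π * z)‖ = 1 := by rw [sub_eq_zero.1 h, norm_one]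
  rw [norm_exp, Real.exp_eq_one_iff] at h1
  have : (2 * π * z).re = 2 * π * z.re := by simp
  rw [this] at h1
  have := mul_pos Real.two_pi_pos hz
  linarith

lemma sq_add_pnat_sq_ne_zero {z : ℂ} (hz : 0 < z.re) (j : ℕ+) : z ^ 2 + (j : ℂ) ^ 2 ≠ 0 := by
  have h : z ^ 2 + (j : ℂ) ^ 2 = (z - j * I) * (z + j * I) := by
    ring_nf; rw [I_sq]; ring
  rw [h]
  refine mul_ne_zero ?_ ?_ <;>
  · intro h0
    have := congrArg Complex.re h0
    simp at this
    linarith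

/-- This is the Mittag-Leffler series of the cotangent at iz, rewritten through π coth(πz) = 2π
(h(z) + 1/2). -/
lemma hasSum_coth {z : ℂ} (hz : 0 < z.re) :
    HasSum (fun j : ℕ+ => 2 * z / (z ^ 2 + (j : ℂ) ^ 2))
      (2 * π * (1 / (exp (2 * π * z) - 1) + 1 / 2) - 1 / z) := by
  have hz0 : z ≠ 0 := by rintro rfl; simp at hz
  have hx : I * z ∈ Complex.integerComplement := by
    rintro ⟨n, hn⟩
    have := congrArg Complex.im hn
    simp at this
    linarith
  have hs := (summable_cotTerm hx).hasSum
  simp only [cotTerm] at hs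
  rw [← cot_series_rep' hx] at hs
  have h2 := hs.mul_left I
  have h3 : HasSum (fun x : ℕ+ => I * (1 / (I * z - (x : ℕ)) + 1 / (I * z + (x : ℕ))))
      (I * (π * cot (π * (I * z)) - 1 / (I * z))) := by
    refine (hasSum_pnat_iff_hasSum_succ
      (f := fun x : ℕ => I * (1 / (I * z - x) + 1 / (I * z + x)))).2 ?_
    simpa using h2
  convert! h3 using 1
  · ext j
    have h4 := sq_add_pnat_sq_ne_zero hz j
    have h5 : I * z - (j : ℕ) ≠ 0 := by
      intro h0
      have := congrArg Complex.im h0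
      simp at this
      linarith
    have h6 : I * z + (j : ℕ) ≠ 0 := by
      intro h0
      have := congrArg Complex.im h0
      simp at this
      linarith
    rw [div_add_div _ _ h5 h6, ← mul_div_assoc, div_eq_div_iff h4 (mul_ne_zero h5 h6)]
    ring_nf
    simp only [I_sq]
    ring
  · rw [Complex.cot_pi_eq_exp_ratio]
    have e1 : exp (2 * π * I * (I * z)) = (exp (2 * π * z))⁻¹ := by
      rw [← exp_neg]; congr 1; ring_nf; rw [I_sq]; ring
    have h4 := exp_two_pi_sub_one_ne_zero hz
    have h5 := exp_ne_zero (2 * π * z)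
    have h6 : 1 - (exp (2 * π * z))⁻¹ = (exp (2 * π * z) - 1) / exp (2 * π * z) := by field_simp
    rw [e1, h6]
    field_simp
    ring

/-- Lipschitz's formula for the sum of 1/(z + n)² over all integers, with n and -n paired and the
term n = 0 moved to the right. -/
lemma hasSum_csc_sq {z : ℂ} (hz : 0 < z.im) :
    HasSum (fun n : ℕ+ => 1 / (z - n) ^ 2 + 1 / (z + n) ^ 2)
      (-(4 * π ^ 2) * (∑' n : ℕ+, (n : ℂ) * exp (2 * π * I * n * z)) - 1 / z ^ 2) := by
  have hq := EisensteinSeries.qExpansion_identity_pnat (k := 1) le_rfl ⟨z, hz⟩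
  have hs : Summable fun n : ℤ => 1 / (z + n) ^ 2 := by
    have := EisensteinSeries.linear_right_summable (⟨z, hz⟩ : UpperHalfPlane) 1 (k := 2) le_rfl
    refine this.congr fun n => ?_
    simp
  have h1 : Summable fun n : ℕ+ => 1 / (z + (n : ℂ)) ^ 2 := by
    have := hs.comp_injective (i := fun n : ℕ+ => (n : ℤ)) (fun a b h => by simpa using h)
    exact this.congr fun n => by simp
  have h2 : Summable fun n : ℕ+ => 1 / (z - (n : ℂ)) ^ 2 := by
    have := hs.comp_injective (i := fun n : ℕ+ => -(n : ℤ)) (fun a b h => by simpa using h)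
    exact this.congr fun n => by simp [sub_eq_add_neg]
  have h3 := tsum_int_eq_zero_add_tsum_pnat hs
  have h4 : ∑' n : ℕ+, (1 / (z - (n : ℂ)) ^ 2 + 1 / (z + (n : ℂ)) ^ 2) =
      -(4 * π ^ 2) * (∑' n : ℕ+, (n : ℂ) * exp (2 * π * I * n * z)) - 1 / z ^ 2 := by
    rw [h2.tsum_add h1]
    have h5 : (∑' n : ℕ+, 1 / (z + ((n : ℤ) : ℂ)) ^ 2) = ∑' n : ℕ+, 1 / (z + (n : ℂ)) ^ 2 := by
      simp
    have h6 : (∑' n : ℕ+, 1 / (z + ((-(n : ℤ) : ℤ) : ℂ)) ^ 2) =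
        ∑' n : ℕ+, 1 / (z - (n : ℂ)) ^ 2 := by simp [sub_eq_add_neg]
    rw [h5, h6] at h3
    have h7 : (∑' n : ℕ+, (n : ℂ) ^ 1 * exp (2 * π * I * z) ^ (n : ℕ)) =
        ∑' n : ℕ+, (n : ℂ) * exp (2 * π * I * n * z) := by
      refine tsum_congr fun n => ?_
      rw [← exp_nat_mul, pow_one]; congr 2; ring
    simp only [Nat.factorial_one, Nat.cast_one] at hq
    rw [show (1 + 1 : ℕ) = 2 from rfl] at hq
    rw [h7, h3] at hq
    have h8 : (-2 * π * I) ^ 2 = -(4 * (π : ℂ) ^ 2) := by ring_nf; rw [I_sq]; ring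
    rw [h8] at hq
    simp only [Int.cast_zero, add_zero, div_one] at hq
    rw [← hq]; ring
  rw [← h4]
  exact (h2.add h1).hasSum

/-- The cosecant series at z = in: its exponential side is the series for h'(n), and its paired
poles combine into the real rational terms. -/
lemma hasSum_boseDeriv (n : ℕ+) :
    HasSum (fun j : ℕ+ => 2 * ((j : ℝ) ^ 2 - (n : ℝ) ^ 2) / ((n : ℝ) ^ 2 + (j : ℝ) ^ 2) ^ 2)
      (2 * π * boseDeriv n + 1 / (n : ℝ) ^ 2) := by
  have hn : (0 : ℝ) < n := pnat_pos n
  have h := hasSum_csc_sq (z := I * n) (by simp)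
  have e : (∑' k : ℕ+, (k : ℂ) * exp (2 * π * I * k * (I * n))) =
      ((-boseDeriv n / (2 * π) : ℝ) : ℂ) := by
    rw [← (hasSum_mul_exp_neg n).tsum_eq, ofReal_tsum]
    refine tsum_congr fun k => ?_
    push_cast
    congr 2
    ring_nf; rw [I_sq]; ring
  rw [e] at h
  rw [← hasSum_ofReal]
  convert! h using 1
  · ext j
    have hj : (0 : ℝ) < j := pnat_pos j
    have h1 : I * (n : ℂ) - j ≠ 0 := by
      intro h0
      have := congrArg Complex.im h0
      simp at this
    have h2 : I * (n : ℂ) + j ≠ 0 := by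
      intro h0
      have := congrArg Complex.im h0
      simp at this
    have h3 : ((n : ℂ) ^ 2 + (j : ℂ) ^ 2) ^ 2 = ((I * n - j) * (I * n + j)) ^ 2 := by
      ring_nf; simp only [I_sq, I_pow_four]; ring
    push_cast
    have h4 : 1 / (I * (n : ℂ) - j) ^ 2 + 1 / (I * (n : ℂ) + j) ^ 2 =
        ((I * n + j) ^ 2 + (I * n - j) ^ 2) / ((I * n - j) * (I * n + j)) ^ 2 := by
      rw [div_add_div _ _ (pow_ne_zero 2 h1) (pow_ne_zero 2 h2), mul_pow]; ring
    rw [h3, h4]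
    congr 1
    ring_nf; rw [I_sq]; ring
  · have h4 : (n : ℂ) ≠ 0 := by exact_mod_cast n.ne_zero
    have h5 : (π : ℂ) ≠ 0 := by exact_mod_cast Real.pi_ne_zero
    push_cast
    rw [mul_pow, I_sq]
    field_simp
    ring

/-! ### Partial fraction expansion of the product -/

lemma exists_norm_inv_sq_add_pnat_sq_le {z : ℂ} (hz : 0 < z.re) :
    ∃ C : ℝ, ∀ j : ℕ+, ‖2 * z / (z ^ 2 + (j : ℂ) ^ 2)‖ ≤ C * (1 / (j : ℝ) ^ 2) := by
  refine ⟨2 * ‖z‖ * (1 + ‖z‖ ^ 2 / z.re ^ 2), fun j => ?_⟩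
  have hj := pnat_pos j
  have hq := sq_add_pnat_sq_ne_zero hz j
  have hlow : z.re ^ 2 ≤ ‖z ^ 2 + (j : ℂ) ^ 2‖ := by
    have hf : z ^ 2 + (j : ℂ) ^ 2 = (z - j * I) * (z + j * I) := by
      ring_nf; rw [I_sq]; ring
    have h1 : z.re ≤ ‖z - j * I‖ := by simpa using re_le_norm (z - j * I)
    have h2 : z.re ≤ ‖z + j * I‖ := by simpa using re_le_norm (z + j * I)
    rw [hf, norm_mul, sq]
    exact mul_le_mul h1 h2 hz.le (norm_nonneg _)
  have e1 : ‖(j : ℂ)‖ ^ 2 = (j : ℝ) ^ 2 := by simp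
  have h3 : (j : ℝ) ^ 2 ≤ (1 + ‖z‖ ^ 2 / z.re ^ 2) * ‖z ^ 2 + (j : ℂ) ^ 2‖ := by
    have h4 : (j : ℝ) ^ 2 ≤ ‖z ^ 2 + (j : ℂ) ^ 2‖ + ‖z‖ ^ 2 := by
      have := norm_sub_le (z ^ 2 + (j : ℂ) ^ 2) (z ^ 2)
      rw [add_sub_cancel_left, norm_pow, norm_pow, e1] at this
      exact this
    have h5 : ‖z‖ ^ 2 ≤ ‖z‖ ^ 2 / z.re ^ 2 * ‖z ^ 2 + (j : ℂ) ^ 2‖ := by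
      calc ‖z‖ ^ 2 = ‖z‖ ^ 2 / z.re ^ 2 * z.re ^ 2 := by field_simp
        _ ≤ _ := by gcongr
    linarith
  rw [norm_div, norm_mul, Complex.norm_ofNat, div_le_iff₀ (norm_pos_iff.2 hq)]
  calc 2 * ‖z‖ = 2 * ‖z‖ * (1 / (j : ℝ) ^ 2) * (j : ℝ) ^ 2 := by field_simp
    _ ≤ 2 * ‖z‖ * (1 / (j : ℝ) ^ 2) * ((1 + ‖z‖ ^ 2 / z.re ^ 2) * ‖z ^ 2 + (j : ℂ) ^ 2‖) := by
        gcongr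
    _ = _ := by ring

/-- The right side is arranged so that each of its three j-dependent coefficients has a known sum
over j: the first by `hasSum_coth` at z, the second by `hasSum_coth` at n, the third by
`hasSum_boseDeriv`. -/
lemma partialFraction_identity {z n j : ℂ} (hm : z - n ≠ 0) (hp : z + n ≠ 0)
    (hq : z ^ 2 + j ^ 2 ≠ 0) (hnj : n ^ 2 + j ^ 2 ≠ 0) :
    2 * (n ^ 2 - j ^ 2) / (n ^ 2 + j ^ 2) ^ 2 * (2 * z / (z ^ 2 + j ^ 2)) =
      2 * z / (z ^ 2 + j ^ 2) * (1 / (z - n) ^ 2 + 1 / (z + n) ^ 2)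
        - 2 * n / (n ^ 2 + j ^ 2) * (1 / (z - n) ^ 2 - 1 / (z + n) ^ 2)
        - 2 * (j ^ 2 - n ^ 2) / (n ^ 2 + j ^ 2) ^ 2 * (1 / (z - n) + 1 / (z + n)) := by
  field_simp
  ring

/-- Half of the case j = 0 of the preceding identity. It absorbs the corrections 1/z, 1/n and 1/n²
that the three summation formulas leave behind. -/
lemma partialFraction_identity_zero {z n : ℂ} (hz : z ≠ 0) (hn : n ≠ 0) (hm : z - n ≠ 0)
    (hp : z + n ≠ 0) :
    2 / z * (1 / n ^ 2) = 1 / z * (1 / (z - n) ^ 2 + 1 / (z + n) ^ 2)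
        - 1 / n * (1 / (z - n) ^ 2 - 1 / (z + n) ^ 2)
        + 1 / n ^ 2 * (1 / (z - n) + 1 / (z + n)) := by
  field_simp
  ring

lemma exists_hasSum_rows_columns {α β : Type*} {f : α → β → ℂ} {a : α → ℂ} {b : β → ℂ}
    (hf : Summable fun p : α × β => f p.1 p.2) (ha : ∀ n, HasSum (f n) (a n))
    (hb : ∀ j, HasSum (fun n => f n j) (b j)) : ∃ S, HasSum a S ∧ HasSum b S :=
  ⟨_, hf.hasSum.prod_fiberwise ha,
    ((Equiv.prodComm β α).hasSum_iff.2 hf.hasSum).prod_fiberwise hb⟩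

/-- The term of the partial fraction expansion of `π² / sin² (πz) / (exp (2πz) - 1)` that collects
the poles at `±n` and `±n i`. -/
noncomputable def polarTerm (n : ℕ+) (z : ℂ) : ℂ :=
  bose n * (1 / (z - n) ^ 2 - 1 / (z + n) ^ 2) - 1 / (z + n) ^ 2 +
    boseDeriv n * (1 / (z - n) + 1 / (z + n) + 1 / (z - n * I) + 1 / (z + n * I))

/-- The coefficients are those of the principal parts: h(-n) = -1 - h(n) and h'(-n) = h'(n) at the
integers, while at ±in the residue is -π / (2 sinh²(πn)), which equals h'(n) again; the subtracted
expression is the principal part at 0. That nothing else remains is proved by summing one absolutely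
convergent double series, s(n, j) · 2z / (z² + j²), by rows and by columns, which avoids contour
integration. -/
lemma hasSum_polarTerm {z : ℂ} (hre : 0 < z.re) (him : 0 < z.im) :
    HasSum (fun n => polarTerm n z)
      (1 / (exp (2 * π * z) - 1) *
          (-(4 * π ^ 2) * (∑' n : ℕ+, (n : ℂ) * exp (2 * π * I * n * z)))
        - (1 / (2 * π * z ^ 3) - 1 / (2 * z ^ 2) + π / 3 / z)) := by
  have hz0 : z ≠ 0 := by rintro rfl; simp at hre
  have hpi : (π : ℂ) ≠ 0 := by exact_mod_cast Real.pi_ne_zero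
  have hn0 : ∀ n : ℕ+, (n : ℂ) ≠ 0 := fun n => by exact_mod_cast n.ne_zero
  have hm : ∀ n : ℕ+, z - n ≠ 0 := fun n h0 => by
    have := congrArg Complex.im h0
    simp at this
    linarith
  have hp : ∀ n : ℕ+, z + n ≠ 0 := fun n h0 => by
    have := congrArg Complex.im h0
    simp at this
    linarith
  have hq : ∀ n : ℕ+, z ^ 2 + (n : ℂ) ^ 2 ≠ 0 := sq_add_pnat_sq_ne_zero hre
  have hnn : ∀ n j : ℕ+, (n : ℂ) ^ 2 + (j : ℂ) ^ 2 ≠ 0 := fun n j =>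
    sq_add_pnat_sq_ne_zero (by simp) j
  set h := 1 / (exp (2 * π * z) - 1) with hh
  set C := -(4 * (π : ℂ) ^ 2) * (∑' n : ℕ+, (n : ℂ) * exp (2 * π * I * n * z)) with hC
  have hV := hasSum_csc_sq him
  have hphi := hasSum_coth hre
  rw [← hC] at hV
  rw [← hh] at hphi
  let s : ℕ+ → ℕ+ → ℂ := fun n j => 2 * ((n : ℂ) ^ 2 - (j : ℂ) ^ 2) / ((n : ℂ) ^ 2 + (j : ℂ) ^ 2) ^ 2
  have hsum_n : ∀ j : ℕ+, HasSum (fun n => s n j) (2 * π * boseDeriv j + 1 / (j : ℂ) ^ 2) := by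
    intro j
    have := hasSum_ofReal.2 (hasSum_boseDeriv j)
    push_cast at this
    convert! this using 1
    ext n
    simp only [s]
    rw [add_comm ((n : ℂ) ^ 2)]
  have hE : ∀ n : ℕ+, HasSum (fun j => s n j * (2 * z / (z ^ 2 + (j : ℂ) ^ 2)))
      (2 * π * ((h + 1 / 2) * (1 / (z - n) ^ 2 + 1 / (z + n) ^ 2)
        - (bose n + 1 / 2) * (1 / (z - n) ^ 2 - 1 / (z + n) ^ 2)
        - boseDeriv n * (1 / (z - n) + 1 / (z + n))) - 2 / z * (1 / (n : ℂ) ^ 2)) := by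
    intro n
    have h1 := hphi.mul_right (1 / (z - n) ^ 2 + 1 / (z + n) ^ 2)
    have h2 := (hasSum_coth (z := (n : ℂ)) (by simp)).mul_right
      (1 / (z - n) ^ 2 - 1 / (z + n) ^ 2)
    have h3 := (hsum_n n).mul_right (1 / (z - n) + 1 / (z + n))
    have e : 1 / (exp (2 * π * n) - 1) = (bose n : ℂ) := by
      rw [bose]; push_cast; rfl
    rw [e] at h2
    convert! (h1.sub h2).sub h3 using 1
    · ext j
      simp only [s]
      rw [add_comm ((j : ℂ) ^ 2) ((n : ℂ) ^ 2)]
      exact partialFraction_identity (hm n) (hp n) (hq j) (hnn n j)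
    · rw [partialFraction_identity_zero hz0 (hn0 n) (hm n) (hp n)]
      ring
  have hprod : Summable fun p : ℕ+ × ℕ+ => s p.1 p.2 * (2 * z / (z ^ 2 + (p.2 : ℂ) ^ 2)) := by
    obtain ⟨K, hK⟩ := exists_norm_inv_sq_add_pnat_sq_le hre
    have hb := (summable_inv_pnat_sq.mul_left 2).mul_of_nonneg (summable_inv_pnat_sq.mul_left K)
      (fun n => by positivity) (fun j => (norm_nonneg _).trans (hK j))
    refine Summable.of_norm_bounded hb fun p => ?_
    rw [norm_mul]
    refine mul_le_mul ?_ (hK _) (norm_nonneg _) (by positivity)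
    have e : s p.1 p.2 = ((2 * ((p.1 : ℝ) ^ 2 - (p.2 : ℝ) ^ 2) /
        ((p.1 : ℝ) ^ 2 + (p.2 : ℝ) ^ 2) ^ 2 : ℝ) : ℂ) := by simp only [s]; push_cast; rfl
    have h1 := pnat_pos p.1
    have h2 := pnat_pos p.2
    rw [e, norm_real, Real.norm_eq_abs, abs_div, abs_of_pos (by positivity : (0 : ℝ) <
      ((p.1 : ℝ) ^ 2 + (p.2 : ℝ) ^ 2) ^ 2), mul_one_div, div_le_div_iff₀ (by positivity) (by positivity),
      abs_mul, abs_two]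
    have h3 : |(p.1 : ℝ) ^ 2 - (p.2 : ℝ) ^ 2| ≤ (p.1 : ℝ) ^ 2 + (p.2 : ℝ) ^ 2 := by
      rw [abs_le]; constructor <;> nlinarith
    calc 2 * |(p.1 : ℝ) ^ 2 - (p.2 : ℝ) ^ 2| * (p.1 : ℝ) ^ 2
        ≤ 2 * ((p.1 : ℝ) ^ 2 + (p.2 : ℝ) ^ 2) * ((p.1 : ℝ) ^ 2 + (p.2 : ℝ) ^ 2) := by
          gcongr; nlinarith
      _ = _ := by ring
  obtain ⟨S, hEn, hEj⟩ := exists_hasSum_rows_columns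
    (f := fun n j : ℕ+ => s n j * (2 * z / (z ^ 2 + (j : ℂ) ^ 2))) hprod hE
    (fun j => (hsum_n j).mul_right (2 * z / (z ^ 2 + (j : ℂ) ^ 2)))
  have hz2 : HasSum (fun n : ℕ+ => 1 / (n : ℂ) ^ 2) ((π : ℂ) ^ 2 / 6) := by
    have := hasSum_ofReal.2 hasSum_pnat_inv_sq
    push_cast at this
    exact this
  -- The unknown common sum S cancels between rows and columns. The two copies of ζ(2) added here
  -- produce the term π/(3z).
  have hfin := ((((hEn.add (hz2.mul_left (2 / z))).sub hEj).add
    ((hz2.mul_left (2 / z)).sub (hphi.mul_right (1 / z ^ 2)))).mul_left (1 / (2 * (π : ℂ))))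
  have hpsi : ∀ n : ℕ+, 1 / (z - n * I) + 1 / (z + n * I) = 2 * z / (z ^ 2 + (n : ℂ) ^ 2) := by
    intro n
    have hf : z ^ 2 + (n : ℂ) ^ 2 = (z - n * I) * (z + n * I) := by
      ring_nf; rw [I_sq]; ring
    have h1 : z - n * I ≠ 0 := fun h0 => hq n (by rw [hf, h0, zero_mul])
    have h2 : z + n * I ≠ 0 := fun h0 => hq n (by rw [hf, h0, mul_zero])
    rw [hf, div_add_div _ _ h1 h2]; ring
  have hj2 : ∀ n : ℕ+, 1 / (n : ℂ) ^ 2 * (2 * z / (z ^ 2 + (n : ℂ) ^ 2)) =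
      2 / z * (1 / (n : ℂ) ^ 2) - 2 * z / (z ^ 2 + (n : ℂ) ^ 2) * (1 / z ^ 2) := by
    intro n
    have := hn0 n; have := hq n
    field_simp
    ring
  convert! (hV.mul_left h).sub hfin using 1
  · ext n
    rw [polarTerm, add_assoc (1 / (z - n) + 1 / (z + n)), hpsi, add_mul (2 * π * (boseDeriv n : ℂ)),
      hj2]
    field_simp
    ring
  · field_simp
    ring

/-! ### Integrating the partial fraction series -/

/-- The quarter plane on which the two antiderivatives are compared. -/
def quadrant (δ : ℝ) : Set ℂ := {z | 1 / 2 < z.re ∧ δ < z.im}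

lemma isOpen_quadrant (δ : ℝ) : IsOpen (quadrant δ) :=
  (isOpen_lt continuous_const continuous_re).inter (isOpen_lt continuous_const continuous_im)

lemma isPreconnected_quadrant (δ : ℝ) : IsPreconnected (quadrant δ) :=
  ((convex_halfSpace_re_gt (1 / 2)).inter (convex_halfSpace_im_gt δ)).isPreconnected

lemma im_le_norm_sub_pnat (z : ℂ) (n : ℕ+) : z.im ≤ ‖z - n‖ := by
  simpa using im_le_norm (z - n)

lemma im_le_norm_add_pnat (z : ℂ) (n : ℕ+) : z.im ≤ ‖z + n‖ := by
  simpa using im_le_norm (z + n)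

lemma re_le_norm_sub_pnat_mul_I (z : ℂ) (n : ℕ+) : z.re ≤ ‖z - n * I‖ := by
  simpa using re_le_norm (z - n * I)

lemma re_le_norm_add_pnat_mul_I (z : ℂ) (n : ℕ+) : z.re ≤ ‖z + n * I‖ := by
  simpa using re_le_norm (z + n * I)

lemma pnat_le_norm_add_pnat {z : ℂ} (hz : 0 ≤ z.re) (n : ℕ+) : (n : ℝ) ≤ ‖z + n‖ := by
  have := re_le_norm (z + n)
  simp at this
  linarith

/-- The antiderivative of `polarTerm n`. -/
noncomputable def logTerm (n : ℕ+) (z : ℂ) : ℂ :=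
  bose n * (-(1 / (z - n)) + 1 / (z + n)) - (1 / n - 1 / (z + n)) +
    boseDeriv n * (log (z - n) + log (z + n) + log (z - n * I) + log (z + n * I))

lemma hasDerivAt_one_div_add {z a : ℂ} (h : z + a ≠ 0) :
    HasDerivAt (fun w => 1 / (w + a)) (-(1 / (z + a) ^ 2)) z := by
  have := ((hasDerivAt_id z).add_const a).inv h
  convert! this using 1
  · ext w; simp
  · simp; ring

lemma hasDerivAt_logTerm {z : ℂ} (hre : 0 < z.re) (him : 0 < z.im) (n : ℕ+) :
    HasDerivAt (logTerm n) (polarTerm n z) z := by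
  have h1 : z + -(n : ℂ) ≠ 0 := fun h0 => by
    have := congrArg Complex.im h0
    simp at this
    linarith
  have h2 : z + n ≠ 0 := fun h0 => by
    have := congrArg Complex.im h0
    simp at this
    linarith
  have hlog : ∀ a : ℂ, z + a ∈ slitPlane →
      HasDerivAt (fun w => log (w + a)) (1 / (z + a)) z := fun a ha => by
    simpa using ((hasDerivAt_id z).add_const a).clog ha
  have l1 := hlog (-n) (Or.inr (by simpa using him.ne'))
  have l2 := hlog n (Or.inr (by simpa using him.ne'))
  have l3 := hlog (-(n * I)) (Or.inl (by simpa using hre))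
  have l4 := hlog (n * I) (Or.inl (by simpa using hre))
  have d1 := hasDerivAt_one_div_add h1
  have d2 := hasDerivAt_one_div_add h2
  have := (((d1.neg.add d2).const_mul (bose n : ℂ)).sub (d2.const_sub (1 / (n : ℂ)))).add
    ((((l1.add l2).add l3).add l4).const_mul (boseDeriv n : ℂ))
  convert! this using 1
  rw [polarTerm]
  simp only [sub_eq_add_neg]
  ring

/-- Apply log x ≤ x - 1 to |w| and to its inverse. A bound linear in R is enough, since the
logarithms are weighted by the exponentially small h'(n). -/
lemma norm_log_le {w : ℂ} {c R : ℝ} (hc : 0 < c) (h1 : c ≤ ‖w‖) (h2 : ‖w‖ ≤ R) :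
    ‖log w‖ ≤ R + 1 / c + π := by
  have hw : 0 < ‖w‖ := hc.trans_le h1
  have hl : ‖log w‖ ≤ |Real.log ‖w‖| + |arg w| := by
    have := Complex.norm_le_abs_re_add_abs_im (log w)
    rwa [log_re, log_im] at this
  have ha := abs_arg_le_pi w
  have hr : |Real.log ‖w‖| ≤ R + 1 / c := by
    have h3 : 0 < 1 / c := by positivity
    rw [abs_le]
    constructor
    · have := Real.log_le_sub_one_of_pos (inv_pos.2 hw)
      rw [Real.log_inv] at this
      have h4 : ‖w‖⁻¹ ≤ 1 / c := by rw [one_div]; gcongr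
      linarith
    · have := Real.log_le_sub_one_of_pos hw
      linarith
  linarith

lemma norm_inv_sub_inv_add_le {z : ℂ} (hz : 0 ≤ z.re) (n : ℕ+) :
    ‖1 / (n : ℂ) - 1 / (z + n)‖ ≤ ‖z‖ * (1 / (n : ℝ) ^ 2) := by
  have hn := pnat_pos n
  have h1 := pnat_le_norm_add_pnat hz n
  have h2 : z + n ≠ 0 := norm_pos_iff.1 (hn.trans_le h1)
  have h3 : (n : ℂ) ≠ 0 := by exact_mod_cast n.ne_zero
  have e : 1 / (n : ℂ) - 1 / (z + n) = z / (n * (z + n)) := by field_simp; ring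
  rw [e, norm_div, norm_mul, div_eq_mul_one_div]
  gcongr
  rw [sq]
  gcongr
  simp

/-- The integration constant 1/n in `logTerm` is what makes this series converge; its sum is ψ(z +
1) + γ. -/
lemma summable_inv_sub_inv_add {z : ℂ} (hz : 0 ≤ z.re) :
    Summable fun n : ℕ+ => 1 / (n : ℂ) - 1 / (z + n) :=
  Summable.of_norm_bounded (summable_inv_pnat_sq.mul_left _) (norm_inv_sub_inv_add_le hz)

lemma summable_bose_term {z : ℂ} (him : 0 < z.im) :
    Summable fun n : ℕ+ => (bose n : ℂ) * (-(1 / (z - n)) + 1 / (z + n)) := by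
  refine Summable.of_norm_bounded ((summable_pow_mul_bose 0).mul_right (1 / z.im + 1 / z.im))
    fun n => ?_
  have h1 := im_le_norm_sub_pnat z n
  have h2 := im_le_norm_add_pnat z n
  rw [pow_zero, one_mul, norm_mul, norm_real, Real.norm_of_nonneg (bose_pos n).le]
  refine mul_le_mul_of_nonneg_left ((norm_add_le _ _).trans ?_) (bose_pos n).le
  rw [norm_neg, norm_div, norm_div, norm_one]
  gcongr

lemma summable_boseDeriv_term {z : ℂ} (hre : 0 < z.re) (him : 0 < z.im) :
    Summable fun n : ℕ+ => (boseDeriv n : ℂ) *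
      (log (z - n) + log (z + n) + log (z - n * I) + log (z + n * I)) := by
  have hs := ((summable_pow_mul_abs_boseDeriv 0).mul_right
      (4 * ‖z‖ + 2 * (1 / z.im) + 2 * (1 / z.re) + 4 * π)).add
      ((summable_pow_mul_abs_boseDeriv 1).mul_right 4)
  refine Summable.of_norm_bounded hs fun n => ?_
  have b1 := norm_log_le him (im_le_norm_sub_pnat z n) (norm_sub_le _ _)
  have b2 := norm_log_le him (im_le_norm_add_pnat z n) (norm_add_le _ _)
  have b3 := norm_log_le hre (re_le_norm_sub_pnat_mul_I z n) (norm_sub_le _ _)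
  have b4 := norm_log_le hre (re_le_norm_add_pnat_mul_I z n) (norm_add_le _ _)
  have e1 : ‖(n : ℂ)‖ = n := by simp
  have e2 : ‖(n : ℂ) * I‖ = n := by simp
  rw [e1] at b1 b2
  rw [e2] at b3 b4
  rw [norm_mul, norm_real, Real.norm_eq_abs]
  calc _ ≤ |boseDeriv n| * (4 * ‖z‖ + 2 * (1 / z.im) + 2 * (1 / z.re) + 4 * π + n * 4) := by
        gcongr
        refine (norm_add_le _ _).trans ?_
        have := (norm_add_le (log (z - n) + log (z + n)) (log (z - n * I)))
        have := norm_add_le (log (z - n)) (log (z + n))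
        linarith
    _ = _ := by ring

lemma summable_logTerm {z : ℂ} (hre : 0 < z.re) (him : 0 < z.im) :
    Summable fun n => logTerm n z :=
  ((summable_bose_term him).sub (summable_inv_sub_inv_add hre.le)).add
    (summable_boseDeriv_term hre him)

lemma norm_polarTerm_le {δ : ℝ} (hδ : 0 < δ) {z : ℂ} (hz : z ∈ quadrant δ) (n : ℕ+) :
    ‖polarTerm n z‖ ≤ bose n * (2 / δ ^ 2) + 1 / (n : ℝ) ^ 2 + |boseDeriv n| * (2 / δ + 4) := by
  obtain ⟨h1, h2⟩ := hz
  have i1 : ‖1 / (z - n)‖ ≤ 1 / δ := by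
    rw [norm_div, norm_one]; gcongr; exact h2.le.trans (im_le_norm_sub_pnat z n)
  have i2 : ‖1 / (z + n)‖ ≤ 1 / δ := by
    rw [norm_div, norm_one]; gcongr; exact h2.le.trans (im_le_norm_add_pnat z n)
  have i2' : ‖1 / (z + n)‖ ≤ 1 / n := by
    have := pnat_pos n
    rw [norm_div, norm_one]; gcongr; exact pnat_le_norm_add_pnat (by linarith) n
  have i3 : ‖1 / (z - n * I)‖ ≤ 2 := by
    rw [norm_div, norm_one, ← one_div_one_div (2 : ℝ)]
    gcongr; exact h1.le.trans (re_le_norm_sub_pnat_mul_I z n)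
  have i4 : ‖1 / (z + n * I)‖ ≤ 2 := by
    rw [norm_div, norm_one, ← one_div_one_div (2 : ℝ)]
    gcongr; exact h1.le.trans (re_le_norm_add_pnat_mul_I z n)
  have j1 : ‖1 / (z - n) ^ 2‖ ≤ 1 / δ ^ 2 := by
    rw [← one_div_pow, norm_pow, ← one_div_pow]; gcongr
  have j2 : ‖1 / (z + n) ^ 2‖ ≤ 1 / δ ^ 2 := by
    rw [← one_div_pow, norm_pow, ← one_div_pow]; gcongr
  have j3 : ‖1 / (z + n) ^ 2‖ ≤ 1 / (n : ℝ) ^ 2 := by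
    rw [← one_div_pow, norm_pow, ← one_div_pow]; gcongr
  rw [polarTerm]
  refine (norm_add_le _ _).trans (add_le_add ((norm_sub_le _ _).trans (add_le_add ?_ j3)) ?_)
  · rw [norm_mul, norm_real, Real.norm_of_nonneg (bose_pos n).le]
    refine mul_le_mul_of_nonneg_left ((norm_sub_le _ _).trans ?_) (bose_pos n).le
    calc _ ≤ 1 / δ ^ 2 + 1 / δ ^ 2 := add_le_add j1 j2
      _ = _ := by ring
  · rw [norm_mul, norm_real, Real.norm_eq_abs]
    refine mul_le_mul_of_nonneg_left ?_ (abs_nonneg _)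
    refine (norm_add_le _ _).trans ?_
    have := norm_add_le (1 / (z - n) + 1 / (z + n)) (1 / (z - n * I))
    have := norm_add_le (1 / (z - n)) (1 / (z + n))
    have e : 2 / δ = 1 / δ + 1 / δ := by ring
    linarith

lemma hasDerivAt_tsum_logTerm {z : ℂ} (hz : z ∈ quadrant 0) :
    HasDerivAt (fun w => ∑' n, logTerm n w) (∑' n, polarTerm n z) z := by
  have him : 0 < z.im := hz.2
  have hδ : 0 < z.im / 2 := by linarith
  -- The derivative bounds degenerate on the real axis, so differentiation takes place in a smaller
  -- quarter plane that still contains z.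
  have hzδ : z ∈ quadrant (z.im / 2) := ⟨hz.1, by linarith⟩
  have hs : Summable fun n : ℕ+ => bose n * (2 / (z.im / 2) ^ 2) + 1 / (n : ℝ) ^ 2 +
      |boseDeriv n| * (2 / (z.im / 2) + 4) := by
    have h0 := summable_pow_mul_bose 0
    have h1 := summable_pow_mul_abs_boseDeriv 0
    simp only [pow_zero, one_mul] at h0 h1
    exact ((h0.mul_right _).add summable_inv_pnat_sq).add (h1.mul_right _)
  exact hasDerivAt_tsum_of_isPreconnected hs (isOpen_quadrant _) (isPreconnected_quadrant _)
    (fun n w hw => hasDerivAt_logTerm (by linarith [hw.1]) (by linarith [hw.2]) n)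
    (fun n w hw => norm_polarTerm_le hδ hw n) hzδ
    (summable_logTerm (by linarith [hz.1]) him) hzδ

/-- The antiderivative obtained from the partial fraction expansion. -/
noncomputable def polarSide (z : ℂ) : ℂ :=
  -(1 / (4 * π * z ^ 2)) + 1 / (2 * z) + π / 3 * log z + ∑' n, logTerm n z

lemma hasDerivAt_polarSide {z : ℂ} (hz : z ∈ quadrant 0) :
    HasDerivAt polarSide (1 / (exp (2 * π * z) - 1) *
      (-(4 * π ^ 2) * (∑' n : ℕ+, (n : ℂ) * exp (2 * π * I * n * z)))) z := by
  have hre : 0 < z.re := by linarith [hz.1]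
  have him : 0 < z.im := hz.2
  have hz0 : z ≠ 0 := by rintro rfl; simp at hre
  have hpi : (π : ℂ) ≠ 0 := by exact_mod_cast Real.pi_ne_zero
  have h1 := hasDerivAt_tsum_logTerm hz
  rw [(hasSum_polarTerm hre him).tsum_eq] at h1
  have hinv := hasDerivAt_inv hz0
  have h2 := ((hinv.pow 2).const_mul (-(1 / (4 * (π : ℂ))))).add (hinv.const_mul (1 / 2))
  have h3 := (hasDerivAt_log (Or.inl hre : z ∈ slitPlane)).const_mul ((π : ℂ) / 3)
  convert! (h2.add h3).add h1 using 1
  · ext w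
    simp only [polarSide, Pi.add_apply, Pi.pow_apply, one_div, mul_inv, inv_pow]
    ring
  · generalize 1 / (exp (2 * π * z) - 1) *
      (-(4 * π ^ 2) * (∑' n : ℕ+, (n : ℂ) * exp (2 * π * I * n * z))) = F
    norm_num
    field_simp
    ring

/-! ### Integrating the exponential series -/

/-- The term of the antiderivative obtained from the expansion in exponentials. -/
noncomputable def expTerm (p : ℕ+ × ℕ+) (z : ℂ) : ℂ :=
  2 * π * I * (p.2 / (p.2 + p.1 * I)) * exp (2 * π * (I * p.2 - p.1) * z)

lemma pnat_add_pnat_mul_I_ne_zero (k n : ℕ+) : (n : ℂ) + k * I ≠ 0 := by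
  intro h0
  have := congrArg Complex.im h0
  simp at this

lemma norm_exp_two_pi (k n : ℕ+) (z : ℂ) : ‖exp (2 * π * (I * n - k) * z)‖ =
    Real.exp (-(2 * π * z.re) * k) * Real.exp (-(2 * π * z.im) * n) := by
  rw [norm_exp, ← Real.exp_add]
  congr 1
  simp
  ring

lemma norm_expTerm_le (p : ℕ+ × ℕ+) (z : ℂ) : ‖expTerm p z‖ ≤
    2 * π * (Real.exp (-(2 * π * z.re) * p.1) * Real.exp (-(2 * π * z.im) * p.2)) := by
  have h : ‖(p.2 : ℂ) / (p.2 + p.1 * I)‖ ≤ 1 := by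
    rw [norm_div]
    refine div_le_one_of_le₀ ?_ (norm_nonneg _)
    simpa using abs_re_le_norm ((p.2 : ℂ) + p.1 * I)
  have hp : ‖2 * (π : ℂ) * I‖ = 2 * π := by simp [abs_of_pos Real.pi_pos]
  rw [expTerm, norm_mul, norm_exp_two_pi, norm_mul, hp]
  have := Real.pi_pos
  refine mul_le_mul_of_nonneg_right ?_ (by positivity)
  nlinarith

lemma summable_exp_mul_exp (p : ℕ) {a b : ℝ} (ha : 0 < a) (hb : 0 < b) :
    Summable fun q : ℕ+ × ℕ+ => Real.exp (-a * q.1) * ((q.2 : ℝ) ^ p * Real.exp (-b * q.2)) := by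
  have h := summable_pow_mul_exp 0 ha
  simp only [pow_zero, one_mul] at h
  exact h.mul_of_nonneg (summable_pow_mul_exp p hb) (fun _ => (Real.exp_pos _).le)
    (fun _ => by positivity)

lemma summable_expTerm {z : ℂ} (hre : 0 < z.re) (him : 0 < z.im) :
    Summable fun p => expTerm p z := by
  have := Real.two_pi_pos
  refine Summable.of_norm_bounded ((summable_exp_mul_exp 0 (mul_pos this hre)
    (mul_pos this him)).mul_left (2 * π)) fun p => ?_
  simpa using norm_expTerm_le p z

/-- The antiderivative obtained from the expansion in exponentials. -/
noncomputable def expSide (z : ℂ) : ℂ := ∑' p, expTerm p z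

lemma hasDerivAt_expTerm (p : ℕ+ × ℕ+) (z : ℂ) : HasDerivAt (expTerm p)
    (-(4 * π ^ 2) * p.2 * exp (2 * π * (I * p.2 - p.1) * z)) z := by
  have h := (((hasDerivAt_id z).const_mul (2 * π * (I * (p.2 : ℂ) - p.1))).cexp).const_mul
    (2 * π * I * ((p.2 : ℂ) / (p.2 + p.1 * I)))
  convert! h using 1
  have h0 := pnat_add_pnat_mul_I_ne_zero p.1 p.2
  have e : I * (p.2 : ℂ) - p.1 = I * (p.2 + p.1 * I) := by ring_nf; rw [I_sq]; ring
  simp only [id_eq]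
  generalize exp (2 * π * (I * (p.2 : ℂ) - p.1) * z) = E
  rw [e]
  generalize (p.2 : ℂ) + p.1 * I = D at h0 ⊢
  field_simp
  rw [I_sq]
  ring

lemma hasDerivAt_expSide {z : ℂ} (hz : z ∈ quadrant 0) :
    HasDerivAt expSide (1 / (exp (2 * π * z) - 1) *
      (-(4 * π ^ 2) * (∑' n : ℕ+, (n : ℂ) * exp (2 * π * I * n * z)))) z := by
  have hre : 0 < z.re := by linarith [hz.1]
  have him : 0 < z.im := hz.2
  have hpi := Real.pi_pos
  have hδ : 0 < z.im / 2 := by linarith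
  have hzδ : z ∈ quadrant (z.im / 2) := ⟨hz.1, by linarith⟩
  -- The rate π in k comes from Re w > 1/2 on the quarter plane.
  have hs := (summable_exp_mul_exp 1 Real.pi_pos (mul_pos Real.two_pi_pos hδ)).mul_left (4 * π ^ 2)
  have hD := hasDerivAt_tsum_of_isPreconnected hs (isOpen_quadrant (z.im / 2))
    (isPreconnected_quadrant _) (fun p w _ => hasDerivAt_expTerm p w) (fun p w hw => ?_) hzδ
    (summable_expTerm hre him) hzδ
  · refine hD.congr_deriv ?_
    have hk := hasSum_exp_neg hre
    have hkn : Summable fun k : ℕ+ => ‖exp (-(2 * π * k * z))‖ := by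
      have := summable_pow_mul_exp 0 (mul_pos Real.two_pi_pos hre)
      refine this.congr fun k => ?_
      rw [norm_exp, pow_zero, one_mul]
      congr 1
      simp
      ring
    have hnn : Summable fun n : ℕ+ => ‖(n : ℂ) * exp (2 * π * I * n * z)‖ := by
      have := summable_pow_mul_exp 1 (mul_pos Real.two_pi_pos him)
      refine this.congr fun k => ?_
      rw [norm_mul, norm_exp, pow_one]
      congr 1
      · simp
      · congr 1
        simp
        ring
    rw [← hk.tsum_eq, mul_left_comm, tsum_mul_tsum_of_summable_norm hkn hnn, ← tsum_mul_left]
    refine tsum_congr fun p => ?_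
    have : exp (2 * π * (I * (p.2 : ℂ) - p.1) * z) =
        exp (-(2 * π * p.1 * z)) * exp (2 * π * I * p.2 * z) := by
      rw [← exp_add]; congr 1; ring
    rw [this]; ring
  · have hp : ‖-(4 * (π : ℂ) ^ 2)‖ = 4 * π ^ 2 := by simp
    rw [norm_mul, norm_mul, norm_exp_two_pi, hp, pow_one]
    have e : ‖(p.2 : ℂ)‖ = p.2 := by simp
    have h1 := pnat_pos p.1
    have h2 := pnat_pos p.2
    rw [e]
    calc 4 * π ^ 2 * p.2 * (Real.exp (-(2 * π * w.re) * p.1) * Real.exp (-(2 * π * w.im) * p.2))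
        ≤ 4 * π ^ 2 * p.2 * (Real.exp (-π * p.1) * Real.exp (-(2 * π * (z.im / 2)) * p.2)) := by
          gcongr
          · nlinarith [hw.1]
          · exact hw.2.le
      _ = _ := by ring

lemma exists_polarSide_sub_expSide_eq :
    ∃ c : ℂ, ∀ z ∈ quadrant 0, polarSide z - expSide z = c := by
  have hd : ∀ z ∈ quadrant 0, HasDerivAt (fun w => polarSide w - expSide w) 0 z := fun z hz =>
    ((hasDerivAt_polarSide hz).sub (hasDerivAt_expSide hz)).congr_deriv (sub_self _)
  exact (isOpen_quadrant 0).exists_is_const_of_deriv_eq_zero (isPreconnected_quadrant 0)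
    (fun z hz => (hd z hz).differentiableAt.differentiableWithinAt) fun z hz => (hd z hz).deriv

/-! ### Real parts and the digamma series -/

/-- Taking real parts turns every complex logarithm into the logarithm of a modulus, so that
branches of the argument play no further role. -/
lemma polarSide_re {z : ℂ} (hre : 0 < z.re) (him : 0 < z.im) :
    (polarSide z).re = (-(1 / (4 * π * z ^ 2)) + 1 / (2 * z)).re + π / 3 * Real.log ‖z‖
      + (∑' n : ℕ+, (bose n : ℂ) * (-(1 / (z - n)) + 1 / (z + n))).re
      - (∑' n : ℕ+, (1 / (n : ℂ) - 1 / (z + n))).re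
      + ∑' n : ℕ+, boseDeriv n * (Real.log ‖z - n‖ + Real.log ‖z + n‖ +
          Real.log ‖z - n * I‖ + Real.log ‖z + n * I‖) := by
  have h1 := summable_bose_term him
  have h2 := summable_inv_sub_inv_add hre.le
  have h3 := summable_boseDeriv_term hre him
  have e : (∑' n, logTerm n z) = (∑' n : ℕ+, (bose n : ℂ) * (-(1 / (z - n)) + 1 / (z + n)))
      - (∑' n : ℕ+, (1 / (n : ℂ) - 1 / (z + n))) + ∑' n : ℕ+, (boseDeriv n : ℂ) *
        (log (z - n) + log (z + n) + log (z - n * I) + log (z + n * I)) := by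
    rw [← h1.tsum_sub h2, ← (h1.sub h2).tsum_add h3]
    rfl
  have e3 : (∑' n : ℕ+, (boseDeriv n : ℂ) *
        (log (z - n) + log (z + n) + log (z - n * I) + log (z + n * I))).re =
      ∑' n : ℕ+, boseDeriv n * (Real.log ‖z - n‖ + Real.log ‖z + n‖ +
          Real.log ‖z - n * I‖ + Real.log ‖z + n * I‖) := by
    rw [re_tsum h3]
    refine tsum_congr fun n => ?_
    rw [re_ofReal_mul, add_re, add_re, add_re, log_re, log_re, log_re, log_re]
  have e4 : ((π : ℂ) / 3 * log z).re = π / 3 * Real.log ‖z‖ := by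
    rw [show (π : ℂ) / 3 = ((π / 3 : ℝ) : ℂ) by push_cast; rfl, re_ofReal_mul, log_re]
  rw [polarSide, e, add_re, add_re, add_re (_ - _), sub_re, e3, e4]
  ring

lemma summable_boseDeriv_log {z : ℂ} (hre : 0 < z.re) (him : 0 < z.im) :
    Summable fun n : ℕ+ => boseDeriv n * (Real.log ‖z - n‖ + Real.log ‖z + n‖ +
          Real.log ‖z - n * I‖ + Real.log ‖z + n * I‖) := by
  refine (hasSum_re (summable_boseDeriv_term hre him).hasSum).summable.congr fun n => ?_
  rw [re_ofReal_mul, add_re, add_re, add_re, log_re, log_re, log_re, log_re]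

/-- The error term in the comparison of a term of the digamma series with a logarithm. -/
noncomputable def digammaError (n : ℕ+) (z : ℂ) : ℝ :=
  (1 / (z + n)).re - (Real.log ‖z + n + 1‖ - Real.log ‖z + n‖)

/-- With w = 1/(z + n), the error is minus the real part of log(1 + w) - w, which is quadratic in w.
-/
lemma abs_digammaError_le {z : ℂ} (hz : 1 ≤ z.re) (n : ℕ+) :
    |digammaError n z| ≤ 1 / ‖z + n‖ ^ 2 := by
  have hn := one_le_pnat n
  have h2 : 2 ≤ ‖z + n‖ := by
    have := re_le_norm (z + n)
    simp at this
    linarith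
  have h0 : z + n ≠ 0 := norm_pos_iff.1 (by linarith)
  set w := 1 / (z + n) with hw
  have hwn : ‖w‖ = 1 / ‖z + n‖ := by rw [hw, norm_div, norm_one]
  have hw2 : ‖w‖ ≤ 1 / 2 := by rw [hwn]; gcongr
  have e : 1 + w = (z + n + 1) / (z + n) := by rw [hw]; field_simp
  have h3 : 0 < ‖z + n + 1‖ := by
    have := re_le_norm (z + n + 1)
    simp at this
    linarith
  have e2 : digammaError n z = -(log (1 + w) - w).re := by
    rw [digammaError, sub_re, log_re, e, norm_div, Real.log_div h3.ne' (by linarith)]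
    ring
  rw [e2, abs_neg]
  refine (abs_re_le_norm _).trans ((norm_log_one_add_sub_self_le (by linarith)).trans ?_)
  rw [← one_div_pow, ← hwn]
  have : (1 - ‖w‖)⁻¹ ≤ 2 := by
    rw [inv_le_comm₀ (by linarith) two_pos]; linarith
  calc ‖w‖ ^ 2 * (1 - ‖w‖)⁻¹ / 2 ≤ ‖w‖ ^ 2 * 2 / 2 := by gcongr
    _ = _ := by ring

lemma abs_digammaError_le_inv_sq {z : ℂ} (hz : 1 ≤ z.re) (n : ℕ+) :
    |digammaError n z| ≤ 1 / (n : ℝ) ^ 2 := by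
  have := pnat_pos n
  refine (abs_digammaError_le hz n).trans ?_
  gcongr
  exact pnat_le_norm_add_pnat (by linarith) n

lemma summable_digammaError {z : ℂ} (hz : 1 ≤ z.re) : Summable fun n => digammaError n z :=
  Summable.of_norm_bounded summable_inv_pnat_sq (abs_digammaError_le_inv_sq hz)

lemma tendsto_log_norm_add_sub_log (z : ℂ) :
    Tendsto (fun N : ℕ => Real.log ‖z + N + 1‖ - Real.log (N + 1)) atTop (𝓝 0) := by
  have h1 : Tendsto (fun N : ℕ => 1 + z * ((1 / ((N : ℝ) + 1) : ℝ) : ℂ)) atTop (𝓝 (1 + z * 0)) := by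
    refine tendsto_const_nhds.add (tendsto_const_nhds.mul ?_)
    exact_mod_cast (continuous_ofReal.tendsto 0).comp tendsto_one_div_add_atTop_nhds_zero_nat
  have h2 : Tendsto (fun N : ℕ => Real.log ‖1 + z * ((1 / ((N : ℝ) + 1) : ℝ) : ℂ)‖) atTop
      (𝓝 (Real.log ‖(1 : ℂ) + z * 0‖)) := h1.norm.log (by simp)
  simp only [mul_zero, add_zero, norm_one, Real.log_one] at h2
  have h3 := h1.norm.eventually (isOpen_ne.mem_nhds (by simp : ‖(1 : ℂ) + z * 0‖ ≠ 0))
  refine h2.congr' ?_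
  filter_upwards [h3] with N hN
  have hN1 : (0 : ℝ) < N + 1 := by positivity
  have hc : (N : ℂ) + 1 ≠ 0 := by exact_mod_cast hN1.ne'
  have e : z + N + 1 = (1 + z * ((1 / ((N : ℝ) + 1) : ℝ) : ℂ)) * (((N : ℝ) + 1 : ℝ) : ℂ) := by
    push_cast
    field_simp
    ring
  rw [e, norm_mul, norm_real, Real.norm_of_nonneg hN1.le, Real.log_mul hN hN1.ne']
  ring

/-- Adding the errors replaces Re 1/(z + n) by a telescoping difference of logarithms. The partial
sums then become H_N - log(N + 1) + log|z + 1| up to o(1), and this is where γ enters. -/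
lemma tsum_inv_sub_inv_add_re {z : ℂ} (hz : 1 ≤ z.re) :
    (∑' n : ℕ+, (1 / (n : ℂ) - 1 / (z + n))).re =
      Real.eulerMascheroniConstant + Real.log ‖z + 1‖ - ∑' n, digammaError n z := by
  have h1 := summable_inv_sub_inv_add (z := z) (by linarith)
  have h2 := summable_digammaError hz
  have h1' := (hasSum_re h1.hasSum)
  have h3 := h1'.add h2.hasSum
  have e : ∀ n : ℕ+, (1 / (n : ℂ) - 1 / (z + n)).re + digammaError n z =
      1 / ((n : ℕ) : ℝ) - (Real.log ‖z + (n : ℕ) + 1‖ - Real.log ‖z + (n : ℕ)‖) := by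
    intro n
    have : (1 / (n : ℂ)).re = 1 / ((n : ℕ) : ℝ) := by
      rw [show 1 / (n : ℂ) = ((1 / ((n : ℕ) : ℝ) : ℝ) : ℂ) by push_cast; rfl, ofReal_re]
    rw [digammaError, sub_re, this]
    ring
  simp only [e] at h3
  have h4 := (hasSum_pnat_iff_hasSum_succ (f := fun n : ℕ =>
    1 / (n : ℝ) - (Real.log ‖z + n + 1‖ - Real.log ‖z + n‖))).1 h3
  have h5 := h4.tendsto_sum_nat
  have h6 : ∀ N : ℕ, ∑ i ∈ Finset.range N, (1 / ((i + 1 : ℕ) : ℝ) -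
      (Real.log ‖z + (i + 1 : ℕ) + 1‖ - Real.log ‖z + (i + 1 : ℕ)‖)) =
      (harmonic N - Real.log (N + 1)) - (Real.log ‖z + N + 1‖ - Real.log (N + 1))
        + Real.log ‖z + 1‖ := by
    intro N
    induction N with
    | zero => simp
    | succ N ih =>
      rw [Finset.sum_range_succ, ih, harmonic_succ]
      push_cast
      rw [show z + (N + 1 : ℂ) = z + N + 1 by ring]
      ring
  simp only [h6] at h5
  have h7 := (Real.tendsto_harmonic_sub_log_add_one.sub
    (tendsto_log_norm_add_sub_log z)).add_const (Real.log ‖z + 1‖)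
  have := tendsto_nhds_unique h5 h7
  linarith

/-! ### Behaviour at infinity and the constant of integration -/

/-- The point on the diagonal along which infinity is approached. -/
noncomputable def diag (t : ℝ) : ℂ := t + t * I

@[simp] lemma diag_re (t : ℝ) : (diag t).re = t := by simp [diag]

@[simp] lemma diag_im (t : ℝ) : (diag t).im = t := by simp [diag]

lemma le_norm_diag (t : ℝ) : t ≤ ‖diag t‖ := by simpa using re_le_norm (diag t)

lemma tendsto_norm_diag : Tendsto (fun t => ‖diag t‖) atTop atTop :=
  tendsto_atTop_mono le_norm_diag tendsto_id

lemma tendsto_inv_diag : Tendsto (fun t => (diag t)⁻¹) atTop (𝓝 0) :=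
  tendsto_inv₀_cobounded.comp (tendsto_norm_atTop_iff_cobounded.1 tendsto_norm_diag)

lemma tendsto_zero_of_norm_le_div {E : Type*} [NormedAddCommGroup E] {f : ℝ → E} {K : ℝ}
    (h : ∀ t, 1 ≤ t → ‖f t‖ ≤ K / t) : Tendsto f atTop (𝓝 0) :=
  squeeze_zero_norm' ((eventually_ge_atTop 1).mono h)
    (tendsto_const_nhds.div_atTop tendsto_id)

lemma tendsto_digamma_diag :
    Tendsto (fun t => (∑' n : ℕ+, (1 / (n : ℂ) - 1 / (diag t + n))).re - Real.log ‖diag t‖)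
      atTop (𝓝 Real.eulerMascheroniConstant) := by
  have h1 : Tendsto (fun t => ∑' n, digammaError n (diag t)) atTop (𝓝 (∑' _ : ℕ+, (0 : ℝ))) := by
    refine tendsto_tsum_of_dominated_convergence summable_inv_pnat_sq (fun n => ?_) ?_
    · refine tendsto_zero_of_norm_le_div (K := 1) fun t ht => ?_
      refine (abs_digammaError_le (by simpa using ht) n).trans ?_
      have h2 : t ≤ ‖diag t + n‖ := by simpa using im_le_norm_add_pnat (diag t) n
      have h3 : t ≤ ‖diag t + n‖ ^ 2 := by nlinarith
      gcongr
    · filter_upwards [eventually_ge_atTop 1] with t ht n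
      exact abs_digammaError_le_inv_sq (by simpa using ht) n
  have h2 : Tendsto (fun t => Real.log ‖1 + (diag t)⁻¹‖) atTop (𝓝 0) := by
    have h3 : Tendsto (fun t => 1 + (diag t)⁻¹) atTop (𝓝 (1 + 0)) :=
      tendsto_const_nhds.add tendsto_inv_diag
    have h4 := h3.norm.log (by simp)
    simpa using h4
  rw [tsum_zero] at h1
  have h5 := (h2.sub h1).const_add Real.eulerMascheroniConstant
  rw [sub_zero, add_zero] at h5
  refine h5.congr' ?_
  filter_upwards [eventually_ge_atTop 1] with t ht
  rw [tsum_inv_sub_inv_add_re (by simpa using ht)]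
  have h6 : 0 < ‖diag t‖ := by linarith [le_norm_diag t]
  have h7 : diag t ≠ 0 := norm_pos_iff.1 h6
  have e : 1 + (diag t)⁻¹ = (diag t + 1) / diag t := by field_simp
  have h8 : 0 < ‖diag t + 1‖ := by
    have := re_le_norm (diag t + 1)
    simp at this
    linarith
  rw [e, norm_div, Real.log_div h8.ne' h6.ne']
  ring

lemma tendsto_bose_diag :
    Tendsto (fun t => ∑' n : ℕ+, (bose n : ℂ) * (-(1 / (diag t - n)) + 1 / (diag t + n)))
      atTop (𝓝 0) := by
  have hs := summable_pow_mul_bose 0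
  simp only [pow_zero, one_mul] at hs
  refine tendsto_zero_of_norm_le_div (K := (∑' n, bose n) * 2) fun t ht => ?_
  rw [mul_div_assoc]
  refine tsum_of_norm_bounded (hs.hasSum.mul_right (2 / t)) fun n => ?_
  have h1 : t ≤ ‖diag t - n‖ := by simpa using im_le_norm_sub_pnat (diag t) n
  have h2 : t ≤ ‖diag t + n‖ := by simpa using im_le_norm_add_pnat (diag t) n
  rw [norm_mul, norm_real, Real.norm_of_nonneg (bose_pos n).le]
  refine mul_le_mul_of_nonneg_left ((norm_add_le _ _).trans ?_) (bose_pos n).le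
  rw [norm_neg, norm_div, norm_div, norm_one]
  calc _ ≤ 1 / t + 1 / t := by gcongr
    _ = _ := by ring

lemma norm_diag_pow_four (t : ℝ) : ‖diag t‖ ^ 4 = 4 * t ^ 4 := by
  have : ‖diag t‖ ^ 2 = 2 * t ^ 2 := by
    rw [← normSq_eq_norm_sq, normSq_apply]; simp; ring
  calc ‖diag t‖ ^ 4 = (‖diag t‖ ^ 2) ^ 2 := by ring
    _ = _ := by rw [this]; ring

/-- The four factors multiply to z⁴ - n⁴, and on the diagonal z⁴ = -4t⁴ is a negative real, so the
modulus is exactly 4t⁴ + n⁴. This makes the diagonal a convenient path. -/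
lemma log_factors_diag {t : ℝ} (ht : 1 ≤ t) (n : ℕ+) :
    Real.log ‖diag t - n‖ + Real.log ‖diag t + n‖ +
      Real.log ‖diag t - n * I‖ + Real.log ‖diag t + n * I‖ =
    4 * Real.log ‖diag t‖ + Real.log (1 + (n : ℝ) ^ 4 / (4 * t ^ 4)) := by
  have h1 : 0 < ‖diag t - n‖ := by
    linarith [diag_im t ▸ im_le_norm_sub_pnat (diag t) n]
  have h2 : 0 < ‖diag t + n‖ := by
    linarith [diag_im t ▸ im_le_norm_add_pnat (diag t) n]
  have h3 : 0 < ‖diag t - n * I‖ := by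
    linarith [diag_re t ▸ re_le_norm_sub_pnat_mul_I (diag t) n]
  have h4 : 0 < ‖diag t + n * I‖ := by
    linarith [diag_re t ▸ re_le_norm_add_pnat_mul_I (diag t) n]
  have h5 : 0 < ‖diag t‖ := by linarith [le_norm_diag t]
  have e : (diag t - n) * (diag t + n) * (diag t - n * I) * (diag t + n * I) =
      ((-(4 * t ^ 4 + (n : ℝ) ^ 4) : ℝ) : ℂ) := by
    rw [diag]
    push_cast
    ring_nf
    simp only [I_sq, I_pow_four, show I ^ 3 = -I from I_pow_three]
    ring
  have e2 : ‖diag t - n‖ * ‖diag t + n‖ * ‖diag t - n * I‖ * ‖diag t + n * I‖ =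
      4 * t ^ 4 + (n : ℝ) ^ 4 := by
    rw [← norm_mul, ← norm_mul, ← norm_mul, e, norm_real, Real.norm_eq_abs, abs_neg,
      abs_of_pos (by positivity)]
  rw [← Real.log_mul h1.ne' h2.ne', ← Real.log_mul (by positivity) h3.ne',
    ← Real.log_mul (by positivity) h4.ne', e2]
  have e3 : 4 * Real.log ‖diag t‖ = Real.log (4 * t ^ 4) := by
    rw [← norm_diag_pow_four, Real.log_pow]; push_cast; rfl
  rw [e3, ← Real.log_mul (by positivity) (by positivity)]
  congr 1
  field_simp

lemma tendsto_boseDeriv_diag :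
    Tendsto (fun t => ∑' n : ℕ+, boseDeriv n * Real.log (1 + (n : ℝ) ^ 4 / (4 * t ^ 4)))
      atTop (𝓝 0) := by
  have hs := summable_pow_mul_abs_boseDeriv 4
  refine tendsto_zero_of_norm_le_div (K := (∑' n : ℕ+, (n : ℝ) ^ 4 * |boseDeriv n|) * 1)
    fun t ht => ?_
  rw [mul_div_assoc]
  refine tsum_of_norm_bounded (hs.hasSum.mul_right (1 / t)) fun n => ?_
  rw [norm_mul, Real.norm_eq_abs, Real.norm_eq_abs]
  have hp : 0 ≤ (n : ℝ) ^ 4 / (4 * t ^ 4) := by positivity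
  rw [abs_of_nonneg (Real.log_nonneg (by linarith))]
  have h1 := Real.log_le_sub_one_of_pos (by linarith : 0 < 1 + (n : ℝ) ^ 4 / (4 * t ^ 4))
  have h2 : t ≤ 4 * t ^ 4 := by
    have : t ≤ t ^ 4 := le_self_pow₀ ht (by norm_num)
    linarith
  have h3 : (n : ℝ) ^ 4 / (4 * t ^ 4) ≤ (n : ℝ) ^ 4 / t := by gcongr
  calc |boseDeriv n| * Real.log (1 + (n : ℝ) ^ 4 / (4 * t ^ 4))
      ≤ |boseDeriv n| * ((n : ℝ) ^ 4 / t) := by gcongr; linarith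
    _ = _ := by ring

lemma tendsto_expSide_diag : Tendsto (fun t => expSide (diag t)) atTop (𝓝 0) := by
  have hs := (summable_exp_mul_exp 0 Real.pi_pos Real.two_pi_pos).mul_left (2 * π)
  refine tendsto_zero_of_norm_le_div (K := (∑' q : ℕ+ × ℕ+, 2 * π * (Real.exp (-π * q.1) *
    ((q.2 : ℝ) ^ 0 * Real.exp (-(2 * π) * q.2)))) * 1) fun t ht => ?_
  rw [mul_div_assoc]
  refine tsum_of_norm_bounded (hs.hasSum.mul_right (1 / t)) fun p => ?_
  refine (norm_expTerm_le p _).trans ?_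
  rw [diag_re, diag_im, pow_zero, one_mul]
  have hpi := Real.pi_gt_three
  have hk := one_le_pnat p.1
  have hn := one_le_pnat p.2
  have h1 : Real.exp (-(2 * π * t) * p.1) ≤ Real.exp (-π * p.1) * (1 / t) := by
    have h2 : Real.exp (-(π * t)) ≤ 1 / t := by
      rw [Real.exp_neg, inv_eq_one_div]
      gcongr
      nlinarith [Real.add_one_le_exp (π * t)]
    calc _ ≤ Real.exp (-π * p.1) * Real.exp (-(π * t)) := by
          rw [← Real.exp_add, Real.exp_le_exp]
          nlinarith [mul_nonneg (by linarith : (0 : ℝ) ≤ t - 1) (by linarith : (0 : ℝ) ≤ p.1),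
            mul_nonneg (by linarith : (0 : ℝ) ≤ t) (by linarith : (0 : ℝ) ≤ p.1 - 1)]
      _ ≤ _ := by gcongr
  have h3 : Real.exp (-(2 * π * t) * p.2) ≤ Real.exp (-(2 * π) * p.2) := by
    rw [Real.exp_le_exp]
    nlinarith [mul_nonneg (by linarith : (0 : ℝ) ≤ t - 1) (by linarith : (0 : ℝ) ≤ p.2)]
  calc _ ≤ 2 * π * ((Real.exp (-π * p.1) * (1 / t)) * Real.exp (-(2 * π) * p.2)) := by gcongr
    _ = _ := by ring

/-- Along the diagonal all terms but the logarithmic ones have limits, which determines the constant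
once the logarithms are known to cancel. -/
lemma polarSide_re_eq {z : ℂ} (hz : z ∈ quadrant 0) :
    (polarSide z).re = (expSide z).re - Real.eulerMascheroniConstant := by
  obtain ⟨c, hc⟩ := exists_polarSide_sub_expSide_eq
  have hsd := summable_pow_mul_abs_boseDeriv 0
  simp only [pow_zero, one_mul] at hsd
  have hsd' : Summable boseDeriv := hsd.of_abs
  -- The total coefficient of log|z|: π/3 from the pole at 0, -1 from the digamma series, 4 h'(n)
  -- from each group of four logarithms.
  set A := π / 3 - 1 + 4 * ∑' n, boseDeriv n with hA
  have hinv : Tendsto (fun t => (-(1 / (4 * π * (diag t) ^ 2)) + 1 / (2 * diag t)).re) atTop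
      (𝓝 0) := by
    have h1 := ((tendsto_inv_diag.pow 2).const_mul (-(1 / (4 * (π : ℂ))))).add
      (tendsto_inv_diag.const_mul (1 / 2 : ℂ))
    have h2 := (continuous_re.tendsto _).comp h1
    simp only [ne_eq, OfNat.ofNat_ne_zero, not_false_eq_true, zero_pow, mul_zero, add_zero,
      zero_re] at h2
    refine h2.congr fun t => ?_
    simp only [Function.comp]
    congr 1
    simp only [one_div, mul_inv, inv_pow]
    ring
  have hr : Tendsto (fun t => c.re - A * Real.log ‖diag t‖) atTop
      (𝓝 (-Real.eulerMascheroniConstant)) := by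
    have h1 := (((hinv.add ((continuous_re.tendsto _).comp tendsto_bose_diag)).sub
      tendsto_digamma_diag).add tendsto_boseDeriv_diag).sub
      ((continuous_re.tendsto _).comp tendsto_expSide_diag)
    simp only [zero_re, add_zero, sub_zero, zero_sub] at h1
    refine h1.congr' ?_
    filter_upwards [eventually_ge_atTop 1] with t ht
    have hq : diag t ∈ quadrant 0 := ⟨by simp; linarith, by simp; linarith⟩
    have h2 := summable_boseDeriv_log (z := diag t) (by simp; linarith) (by simp; linarith)
    have hlog : ∑' n : ℕ+, boseDeriv n * (Real.log ‖diag t - n‖ + Real.log ‖diag t + n‖ +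
        Real.log ‖diag t - n * I‖ + Real.log ‖diag t + n * I‖) =
        (∑' n, boseDeriv n) * (4 * Real.log ‖diag t‖) +
        ∑' n : ℕ+, boseDeriv n * Real.log (1 + (n : ℝ) ^ 4 / (4 * t ^ 4)) := by
      simp only [log_factors_diag ht, mul_add] at h2 ⊢
      have h3 := hsd'.mul_right (4 * Real.log ‖diag t‖)
      have h4 : Summable fun n : ℕ+ =>
          boseDeriv n * Real.log (1 + (n : ℝ) ^ 4 / (4 * t ^ 4)) :=
        (h2.sub h3).congr fun n => by ring
      rw [h3.tsum_add h4, tsum_mul_right]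
    rw [← hc _ hq, sub_re, polarSide_re (by simp; linarith) (by simp; linarith), hlog, hA]
    simp only [Function.comp]
    ring
  -- If A were nonzero, log|z| would have a finite limit. The evaluation of the sum of the h'(n) is
  -- thus a by-product and need not be known beforehand.
  have hA0 : A = 0 := by
    by_contra h
    have h1 : Tendsto (fun t => (c.re - (c.re - A * Real.log ‖diag t‖)) / A) atTop
        (𝓝 ((c.re - -Real.eulerMascheroniConstant) / A)) := (hr.const_sub _).div_const _
    refine not_tendsto_nhds_of_tendsto_atTop
      (Real.tendsto_log_atTop.comp tendsto_norm_diag) _ (h1.congr fun t => ?_)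
    simp only [Function.comp]
    field_simp
    ring
  simp only [hA0, zero_mul, sub_zero] at hr
  have h1 := tendsto_nhds_unique hr tendsto_const_nhds
  have h2 := congrArg Complex.re (hc z hz)
  rw [sub_re, ← h1] at h2
  linarith

/-! ### The partial fraction side near the integer m -/

lemma hasSum_inv_sub_inv_succ {a : ℝ} (ha : 0 ≤ a) :
    HasSum (fun n : ℕ+ => 1 / (a + n) - 1 / (a + 1 + n)) (1 / (a + 1)) := by
  have h := (hasSum_pnat_iff_hasSum_succ (f := fun n : ℕ => 1 / (a + n) - 1 / (a + 1 + n))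
    (m := 1 / (a + 1))).2
  refine h ?_
  rw [hasSum_iff_tendsto_nat_of_nonneg]
  · have h2 : ∀ N : ℕ, ∑ i ∈ Finset.range N, (1 / (a + (i + 1 : ℕ)) - 1 / (a + 1 + (i + 1 : ℕ))) =
        1 / (a + 1) - 1 / (a + 1 + N) := by
      intro N
      induction N with
      | zero => simp
      | succ N ih =>
        rw [Finset.sum_range_succ, ih]
        push_cast
        rw [show a + (N + 1 : ℝ) = a + 1 + N by ring]
        ring
    simp only [h2]
    have h3 : Tendsto (fun N : ℕ => 1 / (a + 1 + (N : ℝ))) atTop (𝓝 0) :=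
      tendsto_const_nhds.div_atTop (tendsto_atTop_add_const_left _ _ tendsto_natCast_atTop_atTop)
    simpa using h3.const_sub (1 / (a + 1))
  · intro i
    rw [sub_nonneg]
    gcongr
    linarith

lemma hasSum_inv_sub_inv_add_nat (m : ℕ) :
    HasSum (fun n : ℕ+ => 1 / (n : ℝ) - 1 / ((m : ℝ) + n)) (∑ j ∈ Finset.Icc 1 m, 1 / (j : ℝ)) := by
  induction m with
  | zero => simp
  | succ m ih =>
    rw [Finset.sum_Icc_succ_top (by omega)]
    convert! ih.add (hasSum_inv_sub_inv_succ (a := m) (by positivity)) using 1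
    · ext n; push_cast; ring
    · push_cast; rfl

/-- The point at height `y` above the integer `m`. -/
noncomputable def above (m : ℕ+) (y : ℝ) : ℂ := m + y * I

@[simp] lemma above_re (m : ℕ+) (y : ℝ) : (above m y).re = m := by simp [above]

@[simp] lemma above_im (m : ℕ+) (y : ℝ) : (above m y).im = y := by simp [above]

lemma tendsto_above (m : ℕ+) : Tendsto (above m) (𝓝[>] 0) (𝓝 (m : ℂ)) := by
  have : Continuous (above m) := by unfold above; fun_prop
  have h := this.tendsto 0
  rw [show above m 0 = m by simp [above]] at h
  exact h.mono_left nhdsWithin_le_nhds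

lemma eventually_small {r : ℝ} (hr : 0 < r) : ∀ᶠ y : ℝ in 𝓝[>] 0, 0 < y ∧ y ≤ r := by
  filter_upwards [Ioo_mem_nhdsGT hr] with y hy using ⟨hy.1, hy.2.le⟩

lemma norm_above_le (m : ℕ+) {y : ℝ} (h0 : 0 < y) (h1 : y ≤ 1) : ‖above m y‖ ≤ m + 1 := by
  refine (norm_add_le _ _).trans ?_
  have : ‖(y : ℂ) * I‖ = y := by simp [abs_of_pos h0]
  rw [this]
  simpa using h1

/-- Distinct integers are at distance at least 1. This keeps all terms with n ≠ m bounded uniformly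
in y. -/
lemma one_le_norm_above_sub {m n : ℕ+} (h : n ≠ m) (y : ℝ) : 1 ≤ ‖above m y - n‖ := by
  have h1 := abs_re_le_norm (above m y - n)
  have h2 : (above m y - n).re = (((m : ℤ) - (n : ℤ) : ℤ) : ℝ) := by simp
  rw [h2] at h1
  refine le_trans ?_ h1
  have h3 : (m : ℤ) - n ≠ 0 := fun h0 => h (by
    have : (m : ℤ) = n := by linarith
    exact_mod_cast this.symm)
  exact_mod_cast Int.one_le_abs h3

lemma one_le_norm_above_add (m n : ℕ+) (y : ℝ) : 1 ≤ ‖above m y + n‖ := by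
  have := pnat_le_norm_add_pnat (z := above m y) (by simp) n
  linarith [one_le_pnat n]

/-- The limit of the `n`-th coefficient of the rational part of `polarSide` at `m`. -/
noncomputable def rationalLimit (m n : ℕ+) : ℝ :=
  if n = m then 1 / (2 * (m : ℝ)) else 2 * (n : ℝ) / ((n : ℝ) ^ 2 - (m : ℝ) ^ 2)

/-- The finite part of the `n`-th coefficient of the logarithmic part of `polarSide` at `m`. -/
noncomputable def logLimit (m n : ℕ+) : ℝ :=
  if n = m then Real.log (4 * (m : ℝ) ^ 3) else Real.log |(n : ℝ) ^ 4 - (m : ℝ) ^ 4|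

lemma above_sub_self (m : ℕ+) (y : ℝ) : above m y - m = y * I := by simp [above]

lemma tendsto_above_bose (m : ℕ+) :
    Tendsto (fun y => (∑' n : ℕ+, (bose n : ℂ) * (-(1 / (above m y - n)) + 1 / (above m y + n))).re)
      (𝓝[>] 0) (𝓝 (∑' n, bose n * rationalLimit m n)) := by
  have hs := (summable_pow_mul_bose 0).mul_right 2
  simp only [pow_zero, one_mul] at hs
  have h : Tendsto (fun y => ∑' n : ℕ+,
      bose n * (-(1 / (above m y - n)) + 1 / (above m y + n)).re) (𝓝[>] 0)
      (𝓝 (∑' n, bose n * rationalLimit m n)) := by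
    refine tendsto_tsum_of_dominated_convergence hs (fun n => ?_) ?_
    · refine Tendsto.const_mul _ ?_
      by_cases hnm : n = m
      · subst hnm
        rw [rationalLimit, if_pos rfl]
        have h1 : Tendsto (fun y => (1 / (above n y + n)).re) (𝓝[>] 0)
            (𝓝 (1 / ((n : ℂ) + n)).re) := by
          refine (continuous_re.tendsto _).comp (tendsto_const_nhds.div
            ((tendsto_above n).add_const _) ?_)
          rw [← two_mul]
          simp
        have e : (1 / ((n : ℂ) + n)).re = 1 / (2 * (n : ℝ)) := by
          rw [show 1 / ((n : ℂ) + n) = ((1 / (2 * (n : ℝ)) : ℝ) : ℂ) by push_cast; ring, ofReal_re]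
        rw [e] at h1
        -- The singular part -1/(iy) is purely imaginary, so only 1/(z + n) survives in the real
        -- part.
        refine h1.congr fun y => ?_
        rw [add_re, above_sub_self]
        simp
      · rw [rationalLimit, if_neg hnm]
        have hne : (m : ℂ) - n ≠ 0 := by
          rw [sub_ne_zero]
          exact_mod_cast Ne.symm hnm
        have hne2 : (m : ℂ) + n ≠ 0 := by
          have := pnat_pos m; have := pnat_pos n
          exact_mod_cast (by positivity : ((m : ℝ) + n) ≠ 0)
        have h1 := (continuous_re.tendsto _).comp
          (((tendsto_const_nhds (x := (1 : ℂ))).div ((tendsto_above m).sub_const (n : ℂ)) hne).neg.add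
          ((tendsto_const_nhds (x := (1 : ℂ))).div ((tendsto_above m).add_const (n : ℂ)) hne2))
        convert! h1 using 2
        rw [show -(1 / ((m : ℂ) - n)) + 1 / ((m : ℂ) + n) =
          ((2 * (n : ℝ) / ((n : ℝ) ^ 2 - (m : ℝ) ^ 2) : ℝ) : ℂ) by
            have h3 : (n : ℂ) ^ 2 - (m : ℂ) ^ 2 ≠ 0 := by
              rw [show (n : ℂ) ^ 2 - (m : ℂ) ^ 2 = -((m - n) * (m + n)) by ring]
              exact neg_ne_zero.2 (mul_ne_zero hne hne2)
            push_cast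
            field_simp
            ring, ofReal_re]
    · refine Eventually.of_forall fun y n => ?_
      rw [norm_mul, Real.norm_of_nonneg (bose_pos n).le]
      refine mul_le_mul_of_nonneg_left ?_ (bose_pos n).le
      rw [add_re]
      refine (norm_add_le _ _).trans ?_
      have h1 : ‖(1 / (above m y + n)).re‖ ≤ 1 := by
        refine (abs_re_le_norm _).trans ?_
        rw [norm_div, norm_one]
        exact div_le_one_of_le₀ (one_le_norm_above_add m n y) (norm_nonneg _)
      have h2 : ‖(-(1 / (above m y - n))).re‖ ≤ 1 := by
        by_cases hnm : n = m
        · subst hnm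
          rw [above_sub_self]
          simp
        · refine (abs_re_le_norm _).trans ?_
          rw [norm_neg, norm_div, norm_one]
          exact div_le_one_of_le₀ (one_le_norm_above_sub hnm y) (norm_nonneg _)
      linarith
  refine h.congr' ?_
  filter_upwards [eventually_small one_pos] with y hy
  rw [re_tsum (summable_bose_term (by simpa using hy.1))]
  exact tsum_congr fun n => (re_ofReal_mul _ _).symm

lemma tendsto_above_digamma (m : ℕ+) :
    Tendsto (fun y => (∑' n : ℕ+, (1 / (n : ℂ) - 1 / (above m y + n))).re) (𝓝[>] 0)
      (𝓝 (∑ j ∈ Finset.Icc 1 (m : ℕ), 1 / (j : ℝ))) := by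
  have h : Tendsto (fun y => ∑' n : ℕ+, (1 / (n : ℂ) - 1 / (above m y + n))) (𝓝[>] 0)
      (𝓝 (∑' n : ℕ+, (1 / (n : ℂ) - 1 / ((m : ℂ) + n)))) := by
    refine tendsto_tsum_of_dominated_convergence
      (summable_inv_pnat_sq.mul_left ((m : ℝ) + 1)) (fun n => ?_) ?_
    · refine tendsto_const_nhds.sub (tendsto_const_nhds.div ((tendsto_above m).add_const _) ?_)
      have := pnat_pos m; have := pnat_pos n
      exact_mod_cast (by positivity : ((m : ℝ) + n) ≠ 0)
    · filter_upwards [eventually_small one_pos] with y hy n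
      refine (norm_inv_sub_inv_add_le (by simp) n).trans ?_
      gcongr
      exact norm_above_le m hy.1 hy.2
  have e : ∑' n : ℕ+, (1 / (n : ℂ) - 1 / ((m : ℂ) + n)) =
      ((∑ j ∈ Finset.Icc 1 (m : ℕ), 1 / (j : ℝ) : ℝ) : ℂ) := by
    rw [← (hasSum_inv_sub_inv_add_nat m).tsum_eq, ofReal_tsum]
    refine tsum_congr fun n => ?_
    push_cast
    rfl
  rw [e] at h
  exact (continuous_re.tendsto _).comp h

lemma norm_one_sub_I_mul (m : ℕ+) :
    ‖(m : ℂ) - m * I‖ * ‖(m : ℂ) + m * I‖ = 2 * (m : ℝ) ^ 2 := by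
  rw [← norm_mul, show ((m : ℂ) - m * I) * (m + m * I) = ((2 * (m : ℝ) ^ 2 : ℝ) : ℂ) by
    push_cast; ring_nf; rw [I_sq]; ring, norm_real, Real.norm_of_nonneg (by positivity)]

lemma norm_pnat_sub_pnat_mul_I_pos (m n : ℕ+) : 0 < ‖(m : ℂ) - n * I‖ :=
  (pnat_pos m).trans_le (by simpa using re_le_norm_sub_pnat_mul_I m n)

lemma norm_pnat_add_pnat_mul_I_pos (m n : ℕ+) : 0 < ‖(m : ℂ) + n * I‖ :=
  (pnat_pos m).trans_le (by simpa using re_le_norm_add_pnat_mul_I m n)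

lemma tendsto_above_log (m : ℕ+) :
    Tendsto (fun y => (∑' n : ℕ+, boseDeriv n * (Real.log ‖above m y - n‖ +
        Real.log ‖above m y + n‖ + Real.log ‖above m y - n * I‖ + Real.log ‖above m y + n * I‖))
        - boseDeriv m * Real.log y)
      (𝓝[>] 0) (𝓝 (∑' n, boseDeriv n * logLimit m n)) := by
  have hs := ((summable_pow_mul_abs_boseDeriv 0).mul_right (4 * ((m : ℝ) + 1))).add
    ((summable_pow_mul_abs_boseDeriv 1).mul_right 4)
  -- For n = m the dropped factor is log|iy| = log y, exactly the subtracted singularity. The other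
  -- three factors tend to 2m · 2m² = 4m³ in modulus.
  have h : Tendsto (fun y => ∑' n : ℕ+, boseDeriv n * ((if n = m then 0 else
        Real.log ‖above m y - n‖) +
        Real.log ‖above m y + n‖ + Real.log ‖above m y - n * I‖ + Real.log ‖above m y + n * I‖))
      (𝓝[>] 0) (𝓝 (∑' n, boseDeriv n * logLimit m n)) := by
    refine tendsto_tsum_of_dominated_convergence hs (fun n => ?_) ?_
    · refine Tendsto.const_mul _ ?_
      have hm := pnat_pos m
      have hn := pnat_pos n
      have n2 : 0 < ‖(m : ℂ) + n‖ := by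
        have := pnat_le_norm_add_pnat (z := (m : ℂ)) (by simp) n
        linarith
      have n3 := norm_pnat_sub_pnat_mul_I_pos m n
      have n4 := norm_pnat_add_pnat_mul_I_pos m n
      have l2 := ((tendsto_above m).add_const (n : ℂ)).norm.log n2.ne'
      have l3 := ((tendsto_above m).sub_const ((n : ℂ) * I)).norm.log n3.ne'
      have l4 := ((tendsto_above m).add_const ((n : ℂ) * I)).norm.log n4.ne'
      by_cases hnm : n = m
      · subst hnm
        simp only [if_pos]
        convert! ((tendsto_const_nhds (x := (0 : ℝ))).add l2).add l3 |>.add l4 using 2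
        rw [logLimit, if_pos rfl, zero_add, ← Real.log_mul n2.ne' n3.ne',
          ← Real.log_mul (by positivity) n4.ne', mul_assoc, norm_one_sub_I_mul]
        congr 1
        rw [← two_mul]
        simp
        ring
      · have hne : (m : ℂ) - n ≠ 0 := by
          rw [sub_ne_zero]
          exact_mod_cast Ne.symm hnm
        have n1 := norm_pos_iff.2 hne
        have l1 := ((tendsto_above m).sub_const (n : ℂ)).norm.log n1.ne'
        simp only [if_neg hnm]
        convert! (l1.add l2).add l3 |>.add l4 using 2
        rw [logLimit, if_neg hnm, ← Real.log_mul n1.ne' n2.ne', ← Real.log_mul (by positivity) n3.ne',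
          ← Real.log_mul (by positivity) n4.ne', ← norm_mul, ← norm_mul, ← norm_mul]
        congr 1
        rw [show ((m : ℂ) - n) * (m + n) * (m - n * I) * (m + n * I) =
          (((m : ℝ) ^ 4 - (n : ℝ) ^ 4 : ℝ) : ℂ) by
            push_cast; ring_nf; rw [I_sq]; ring, norm_real, Real.norm_eq_abs, abs_sub_comm]
    · filter_upwards [eventually_small one_pos] with y hy n
      have hz := norm_above_le m hy.1 hy.2
      have e1 : ‖(n : ℂ)‖ = n := by simp
      have e2 : ‖(n : ℂ) * I‖ = n := by simp
      have key : ∀ w : ℂ, 1 ≤ ‖w‖ → ‖w‖ ≤ m + 1 + n → ‖Real.log ‖w‖‖ ≤ m + 1 + n := by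
        intro w h1 h2
        rw [Real.norm_of_nonneg (Real.log_nonneg h1)]
        linarith [Real.log_le_sub_one_of_pos (by linarith : 0 < ‖w‖)]
      have b2 := key _ (one_le_norm_above_add m n y) ((norm_add_le _ _).trans (by linarith))
      have b3 := key (above m y - n * I) ((one_le_pnat m).trans
        (by simpa using re_le_norm_sub_pnat_mul_I (above m y) n))
        ((norm_sub_le _ _).trans (by linarith))
      have b4 := key (above m y + n * I) ((one_le_pnat m).trans
        (by simpa using re_le_norm_add_pnat_mul_I (above m y) n))
        ((norm_add_le _ _).trans (by linarith))
      have b1 : ‖(if n = m then 0 else Real.log ‖above m y - n‖)‖ ≤ m + 1 + n := by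
        split_ifs with hnm
        · rw [norm_zero]; positivity
        · exact key _ (one_le_norm_above_sub hnm y) ((norm_sub_le _ _).trans (by linarith))
      rw [norm_mul, Real.norm_eq_abs (boseDeriv n), pow_zero, pow_one, one_mul]
      calc _ ≤ |boseDeriv n| * (4 * (m + 1 + n)) := by
            gcongr
            refine (norm_add₃_le.trans (add_le_add_left (add_le_add_left (norm_add_le _ _) _) _)).trans ?_
            linarith
        _ = _ := by ring
  refine h.congr' ?_
  filter_upwards [eventually_small one_pos] with y hy
  have hsum := summable_boseDeriv_log (z := above m y) (by simp)
    (by simpa using hy.1)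
  have hite : HasSum (fun n => if n = m then boseDeriv m * Real.log y else 0)
      (boseDeriv m * Real.log y) := hasSum_ite_eq m _
  refine HasSum.tsum_eq ?_
  convert! hsum.hasSum.sub hite using 1
  ext n
  by_cases hnm : n = m
  · subst hnm
    simp only [if_pos, above_sub_self]
    have : ‖(y : ℂ) * I‖ = y := by simp [abs_of_pos hy.1]
    rw [this]
    ring
  · simp only [if_neg hnm]
    ring

lemma tendsto_polarSide_above (m : ℕ+) :
    Tendsto (fun y => (polarSide (above m y)).re - boseDeriv m * Real.log y) (𝓝[>] 0)
      (𝓝 (-(1 / (4 * π * (m : ℝ) ^ 2)) + 1 / (2 * (m : ℝ)) + π / 3 * Real.log m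
        + ∑' n, bose n * rationalLimit m n - ∑ j ∈ Finset.Icc 1 (m : ℕ), 1 / (j : ℝ)
        + ∑' n, boseDeriv n * logLimit m n)) := by
  have hm : (m : ℂ) ≠ 0 := by exact_mod_cast m.ne_zero
  have hpi : (π : ℂ) ≠ 0 := by exact_mod_cast Real.pi_ne_zero
  have h1 : Tendsto (fun y => (-(1 / (4 * π * (above m y) ^ 2)) + 1 / (2 * above m y)).re)
      (𝓝[>] 0) (𝓝 (-(1 / (4 * π * (m : ℝ) ^ 2)) + 1 / (2 * (m : ℝ)))) := by
    have h2 := (continuous_re.tendsto _).comp (((tendsto_const_nhds (x := (1 : ℂ))).div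
      (((tendsto_above m).pow 2).const_mul (4 * (π : ℂ)))
        (mul_ne_zero (mul_ne_zero (by norm_num) hpi) (pow_ne_zero 2 hm))).neg.add
      ((tendsto_const_nhds (x := (1 : ℂ))).div ((tendsto_above m).const_mul 2)
        (mul_ne_zero two_ne_zero hm)))
    convert! h2 using 2
    rw [show -(1 / (4 * (π : ℂ) * (m : ℂ) ^ 2)) + 1 / (2 * (m : ℂ)) =
      ((-(1 / (4 * π * (m : ℝ) ^ 2)) + 1 / (2 * (m : ℝ)) : ℝ) : ℂ) by push_cast; rfl, ofReal_re]
  have h2 : Tendsto (fun y => π / 3 * Real.log ‖above m y‖) (𝓝[>] 0) (𝓝 (π / 3 * Real.log m)) := by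
    have := ((tendsto_above m).norm.log (norm_ne_zero_iff.2 hm)).const_mul (π / 3)
    simpa using this
  refine ((((h1.add h2).add (tendsto_above_bose m)).sub (tendsto_above_digamma m)).add
    (tendsto_above_log m)).congr' ?_
  filter_upwards [eventually_small one_pos] with y hy
  rw [polarSide_re (by simp) (by simpa using hy.1)]
  ring

/-! ### The exponential side near the integer m -/

lemma norm_inv_pnat_mul_le (k n : ℕ+) :
    ‖1 / ((n : ℂ) * (n + k * I))‖ ≤ 1 / (n : ℝ) ^ 2 := by
  have hn := pnat_pos n
  have h : (n : ℝ) ≤ ‖(n : ℂ) + k * I‖ := by simpa using re_le_norm_add_pnat_mul_I n k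
  rw [norm_div, norm_one, norm_mul, sq, show ‖(n : ℂ)‖ = n by simp]
  gcongr

/-- The Lerch-type series `∑ exp (-2πny) / (n (n + ik))`. -/
noncomputable def lerch (k : ℕ+) (y : ℝ) : ℂ :=
  ∑' n : ℕ+, (Real.exp (-(2 * π * y) * n) : ℂ) * (1 / ((n : ℂ) * (n + k * I)))

lemma norm_lerch_term_le (k n : ℕ+) {y : ℝ} (hy : 0 ≤ y) :
    ‖(Real.exp (-(2 * π * y) * n) : ℂ) * (1 / ((n : ℂ) * (n + k * I)))‖ ≤ 1 / (n : ℝ) ^ 2 := by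
  rw [norm_mul, norm_real, Real.norm_of_nonneg (Real.exp_pos _).le]
  have h1 : Real.exp (-(2 * π * y) * n) ≤ 1 := by
    rw [Real.exp_le_one_iff, neg_mul, neg_nonpos]
    have := Real.pi_pos
    positivity
  calc _ ≤ 1 * (1 / (n : ℝ) ^ 2) :=
        mul_le_mul h1 (norm_inv_pnat_mul_le k n) (norm_nonneg _) zero_le_one
    _ = _ := one_mul _

lemma summable_lerch (k : ℕ+) {y : ℝ} (hy : 0 ≤ y) :
    Summable fun n : ℕ+ => (Real.exp (-(2 * π * y) * n) : ℂ) * (1 / ((n : ℂ) * (n + k * I))) :=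
  Summable.of_norm_bounded summable_inv_pnat_sq fun n => norm_lerch_term_le k n hy

lemma norm_lerch_le (k : ℕ+) {y : ℝ} (hy : 0 ≤ y) : ‖lerch k y‖ ≤ π ^ 2 / 6 :=
  tsum_of_norm_bounded hasSum_pnat_inv_sq fun n => norm_lerch_term_le k n hy

lemma tendsto_lerch (k : ℕ+) : Tendsto (lerch k) (𝓝[>] 0) (𝓝 (lerch k 0)) := by
  refine tendsto_tsum_of_dominated_convergence summable_inv_pnat_sq (fun n => ?_) ?_
  · refine Tendsto.mul_const _ ?_
    have : Continuous fun y : ℝ => (Real.exp (-(2 * π * y) * n) : ℂ) := by fun_prop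
    exact (this.tendsto 0).mono_left nhdsWithin_le_nhds
  · filter_upwards [eventually_small one_pos] with y hy n
    exact norm_lerch_term_le k n hy.1.le

lemma hasSum_expTerm_row (m k : ℕ+) {y : ℝ} (hy : 0 < y) :
    HasSum (fun n => expTerm (k, n) (above m y))
      (2 * π * Real.exp (-(2 * π * k * m)) * (exp (-(2 * π * k * y * I)) *
        (I * (1 / (Real.exp (2 * π * y) - 1) : ℝ) - k * (Real.log (1 - Real.exp (-(2 * π * y))) : ℝ)
          - I * k ^ 2 * lerch k y))) := by
  have hpi := Real.pi_pos
  have h1 : HasSum (fun n : ℕ+ => (Real.exp (-(2 * π * y) * n) : ℂ))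
      ((1 / (Real.exp (2 * π * y) - 1) : ℝ) : ℂ) := by
    convert! hasSum_exp_neg (z := (y : ℂ)) (by simpa using hy) using 1
    · ext n
      push_cast
      congr 1
      ring
    · push_cast; rfl
  have hq : Real.exp (-(2 * π * y)) < 1 := by
    rw [Real.exp_lt_one_iff]; nlinarith [mul_pos hpi hy]
  have h2 : HasSum (fun n : ℕ+ => ((Real.exp (-(2 * π * y) * n) / n : ℝ) : ℂ))
      ((-Real.log (1 - Real.exp (-(2 * π * y))) : ℝ) : ℂ) := by
    rw [hasSum_ofReal]
    have h3 := Real.hasSum_pow_div_log_of_abs_lt_one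
      (x := Real.exp (-(2 * π * y))) (by rwa [abs_of_pos (Real.exp_pos _)])
    convert! (hasSum_pnat_iff_hasSum_succ
      (f := fun n : ℕ => Real.exp (-(2 * π * y)) ^ n / n)).2 (by exact_mod_cast h3) using 1
    ext n
    rw [← Real.exp_nat_mul]
    congr 2
    ring
  have h3 := (summable_lerch k hy.le).hasSum
  have h4 := (((h1.mul_left I).add (h2.mul_left (k : ℂ))).sub (h3.mul_left (I * (k : ℂ) ^ 2))).mul_left
    (2 * π * Real.exp (-(2 * π * k * m)) * exp (-(2 * π * k * y * I)))
  convert! h4 using 1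
  · ext n
    have hn : (n : ℂ) ≠ 0 := by exact_mod_cast n.ne_zero
    have hD := pnat_add_pnat_mul_I_ne_zero k n
    have e1 : exp (2 * π * (I * n - k) * above m y) = Real.exp (-(2 * π * k * m)) *
        exp (-(2 * π * k * y * I)) * Real.exp (-(2 * π * y) * n) := by
      -- Because m is an integer, the oscillating factor e^{2πinm} is 1.
      have e2 : 2 * π * (I * n - k) * above m y = ((-(2 * π * k * m) : ℝ) : ℂ) +
          (-(2 * π * k * y * I)) + ((-(2 * π * y) * n : ℝ) : ℂ) +
          ((n * m : ℕ) : ℂ) * (2 * π * I) := by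
        rw [above]; push_cast; ring_nf; rw [I_sq]; ring
      rw [e2, exp_add, exp_nat_mul_two_pi_mul_I, exp_add, exp_add, ofReal_exp, ofReal_exp, mul_one]
    -- Expansion of n/(n + ik) to second order in 1/n: the three pieces give the geometric series,
    -- the logarithmic series and the remainder `lerch`, which stays bounded as y → 0.
    have e3 : I * ((n : ℂ) / (n + k * I)) =
        I + k / n - I * (k : ℂ) ^ 2 * (1 / ((n : ℂ) * (n + k * I))) := by
      generalize hd : (n : ℂ) + k * I = D at hD ⊢
      field_simp
      rw [← hd]
      ring_nf
      rw [I_sq]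
      ring
    rw [expTerm, e1, mul_assoc (2 * (π : ℂ)) I, e3]
    push_cast
    ring
  · rw [lerch]
    push_cast
    ring

/-- The real part of a row of `expSide`, with its logarithmic singularity removed. -/
noncomputable def rowTerm (k : ℕ+) (y : ℝ) : ℝ :=
  Real.sin (2 * π * k * y) * (1 / (Real.exp (2 * π * y) - 1))
    + k * (Real.log y - Real.cos (2 * π * k * y) * Real.log (1 - Real.exp (-(2 * π * y))))
    + k ^ 2 * (exp (-(2 * π * k * y * I)) * (-I * lerch k y)).re

lemma expTerm_row_re (k : ℕ+) (y : ℝ) :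
    (exp (-(2 * π * k * y * I)) *
        (I * (1 / (Real.exp (2 * π * y) - 1) : ℝ) - k * (Real.log (1 - Real.exp (-(2 * π * y))) : ℝ)
          - I * k ^ 2 * lerch k y)).re = rowTerm k y - k * Real.log y := by
  have e : exp (-(2 * π * k * y * I)) = Real.cos (2 * π * k * y) - Real.sin (2 * π * k * y) * I := by
    have : -(2 * π * k * y * I) = ((-(2 * π * k * y) : ℝ) : ℂ) * I := by push_cast; ring
    rw [this, exp_mul_I, ← ofReal_cos, ← ofReal_sin, Real.cos_neg, Real.sin_neg]
    push_cast
    ring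
  have e2 : exp (-(2 * π * k * y * I)) *
        (I * (1 / (Real.exp (2 * π * y) - 1) : ℝ) - k * (Real.log (1 - Real.exp (-(2 * π * y))) : ℝ)
          - I * k ^ 2 * lerch k y) =
      exp (-(2 * π * k * y * I)) *
        (I * (1 / (Real.exp (2 * π * y) - 1) : ℝ) - k * (Real.log (1 - Real.exp (-(2 * π * y))) : ℝ))
      + (((k : ℝ) ^ 2 : ℝ) : ℂ) * (exp (-(2 * π * k * y * I)) * (-I * lerch k y)) := by
    push_cast
    ring
  rw [e2, add_re, re_ofReal_mul, rowTerm, e]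
  generalize (1 / (Real.exp (2 * π * y) - 1) : ℝ) = A
  generalize Real.log (1 - Real.exp (-(2 * π * y))) = B
  generalize Real.cos (2 * π * k * y) = c
  generalize Real.sin (2 * π * k * y) = s
  have e3 : (((c : ℂ) - s * I) * (I * A - k * B)).re = s * A - k * c * B := by
    simp
    ring
  rw [e3]
  ring

lemma one_sub_exp_bounds {y : ℝ} (h0 : 0 < y) (h1 : y ≤ 1 / 2) :
    y ≤ 1 - Real.exp (-(2 * π * y)) ∧ 1 - Real.exp (-(2 * π * y)) ≤ 2 * π * y := by
  have hpi := Real.pi_gt_three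
  constructor
  · have hx : 0 < 2 * π * y := by positivity
    have h2 := Real.add_one_le_exp (2 * π * y)
    have h3 : Real.exp (-(2 * π * y)) ≤ 1 - y := by
      rw [Real.exp_neg]
      refine inv_le_of_inv_le₀ (by linarith) ?_
      refine le_trans ?_ h2
      rw [inv_le_iff_one_le_mul₀ (by linarith)]
      nlinarith
    linarith
  · linarith [Real.add_one_le_exp (-(2 * π * y))]

lemma abs_log_one_sub_exp_le {y : ℝ} (h0 : 0 < y) (h1 : y ≤ 1 / 2) :
    |Real.log (1 - Real.exp (-(2 * π * y)))| ≤ 1 / y := by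
  obtain ⟨h2, -⟩ := one_sub_exp_bounds h0 h1
  have h3 : 1 - Real.exp (-(2 * π * y)) ≤ 1 := by linarith [Real.exp_pos (-(2 * π * y))]
  rw [abs_of_nonpos (Real.log_nonpos (by linarith) h3), ← Real.log_inv]
  have h4 : (1 - Real.exp (-(2 * π * y)))⁻¹ ≤ 1 / y := by
    rw [one_div]; gcongr
  have := Real.log_le_sub_one_of_pos (inv_pos.2 (h0.trans_le h2))
  linarith

lemma abs_log_sub_log_le {y : ℝ} (h0 : 0 < y) (h1 : y ≤ 1 / 2) :
    |Real.log y - Real.log (1 - Real.exp (-(2 * π * y)))| ≤ 2 * π := by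
  obtain ⟨h2, h3⟩ := one_sub_exp_bounds h0 h1
  have h4 := Real.log_le_log h0 h2
  have h5 := Real.log_le_log (h0.trans_le h2) h3
  rw [Real.log_mul (by positivity) h0.ne'] at h5
  have h6 := Real.log_le_sub_one_of_pos Real.two_pi_pos
  rw [abs_le]
  constructor <;> linarith [Real.pi_pos]

/-- The quadratic vanishing of 1 - cos outweighs even the crude bound 1/y for the logarithm. -/
lemma abs_one_sub_cos_mul_log_le (k : ℕ+) {y : ℝ} (h0 : 0 < y) (h1 : y ≤ 1 / 2) :
    |(1 - Real.cos (2 * π * k * y)) * Real.log (1 - Real.exp (-(2 * π * y)))| ≤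
      2 * π ^ 2 * k ^ 2 * y := by
  rw [abs_mul, abs_of_nonneg (by linarith [Real.cos_le_one (2 * π * k * y)])]
  have h2 : 1 - Real.cos (2 * π * k * y) ≤ (2 * π * k * y) ^ 2 / 2 := by
    linarith [Real.one_sub_sq_div_two_le_cos (x := 2 * π * k * y)]
  calc _ ≤ (2 * π * k * y) ^ 2 / 2 * (1 / y) :=
        mul_le_mul h2 (abs_log_one_sub_exp_le h0 h1) (abs_nonneg _) (by positivity)
    _ = _ := by field_simp

lemma abs_sin_mul_le (k : ℕ+) {y : ℝ} (h0 : 0 < y) :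
    |Real.sin (2 * π * k * y) * (1 / (Real.exp (2 * π * y) - 1))| ≤ k := by
  have hx : 0 < 2 * π * y := mul_pos Real.two_pi_pos h0
  have h2 := Real.add_one_le_exp (2 * π * y)
  have h3 : |Real.sin (2 * π * k * y)| ≤ 2 * π * k * y := by
    have := Real.abs_sin_le_abs (x := 2 * π * k * y)
    rwa [abs_of_nonneg (by have := Real.pi_pos; positivity : 0 ≤ 2 * π * k * y)] at this
  have h4 : 0 < 1 / (Real.exp (2 * π * y) - 1) := one_div_pos.2 (by linarith)
  rw [abs_mul, abs_of_pos h4]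
  calc _ ≤ 2 * π * k * y * (1 / (2 * π * y)) :=
        mul_le_mul h3 (one_div_le_one_div_of_le hx (by linarith)) h4.le ((abs_nonneg _).trans h3)
    _ = _ := by field_simp

lemma rowTerm_log_eq (k : ℕ+) (y : ℝ) :
    Real.log y - Real.cos (2 * π * k * y) * Real.log (1 - Real.exp (-(2 * π * y))) =
    (Real.log y - Real.log (1 - Real.exp (-(2 * π * y)))) +
      (1 - Real.cos (2 * π * k * y)) * Real.log (1 - Real.exp (-(2 * π * y))) := by
  ring

lemma norm_exp_neg_mul_I (k : ℕ+) (y : ℝ) : ‖exp (-(2 * π * k * y * I))‖ = 1 := by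
  have : -(2 * π * k * y * I) = ((-(2 * π * k * y) : ℝ) : ℂ) * I := by push_cast; ring
  rw [this, norm_exp_ofReal_mul_I]

/-- A bound uniform in y and polynomial in k, hence summable against e^{-2πkm}; it provides the
majorant for passing to the limit in the sum over k. -/
lemma abs_rowTerm_le (k : ℕ+) {y : ℝ} (h0 : 0 < y) (h1 : y ≤ 1 / 2) :
    |rowTerm k y| ≤ (1 + 2 * π + 2 * π ^ 2 + π ^ 2 / 6) * (k : ℝ) ^ 3 := by
  have hk := one_le_pnat k
  have hpi := Real.pi_pos
  have b1 := abs_sin_mul_le k h0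
  have b2 : |(k : ℝ) * (Real.log y - Real.cos (2 * π * k * y) *
      Real.log (1 - Real.exp (-(2 * π * y))))| ≤ k * (2 * π + 2 * π ^ 2 * k ^ 2) := by
    rw [abs_mul, abs_of_pos (pnat_pos k), rowTerm_log_eq]
    refine mul_le_mul_of_nonneg_left ((abs_add_le _ _).trans (add_le_add
      (abs_log_sub_log_le h0 h1) ((abs_one_sub_cos_mul_log_le k h0 h1).trans ?_))) (pnat_pos k).le
    refine mul_le_of_le_one_right (by positivity) (by linarith)
  have b3 : |(k : ℝ) ^ 2 * (exp (-(2 * π * k * y * I)) * (-I * lerch k y)).re| ≤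
      k ^ 2 * (π ^ 2 / 6) := by
    rw [abs_mul, abs_of_nonneg (by positivity : 0 ≤ (k : ℝ) ^ 2)]
    refine mul_le_mul_of_nonneg_left ((abs_re_le_norm _).trans ?_) (by positivity)
    rw [norm_mul, norm_mul, norm_neg, norm_I, norm_exp_neg_mul_I, one_mul, one_mul]
    exact norm_lerch_le k h0.le
  have c1 : (k : ℝ) ≤ k ^ 3 := le_self_pow₀ hk (by norm_num)
  have c2 : (k : ℝ) ^ 2 ≤ k ^ 3 := pow_le_pow_right₀ hk (by norm_num)
  rw [rowTerm]
  refine (abs_add_le _ _).trans ((add_le_add_left (abs_add_le _ _) _).trans ?_)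
  calc _ ≤ k + k * (2 * π + 2 * π ^ 2 * k ^ 2) + k ^ 2 * (π ^ 2 / 6) :=
        add_le_add (add_le_add b1 b2) b3
    _ = k + 2 * π * k + 2 * π ^ 2 * k ^ 3 + π ^ 2 / 6 * k ^ 2 := by ring
    _ ≤ k ^ 3 + 2 * π * k ^ 3 + 2 * π ^ 2 * k ^ 3 + π ^ 2 / 6 * k ^ 3 := by gcongr
    _ = _ := by ring

lemma tendsto_exp_sub_one_div : Tendsto (fun y : ℝ => (Real.exp (2 * π * y) - 1) / y) (𝓝[>] 0)
    (𝓝 (2 * π)) := by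
  have h : HasDerivAt (fun y : ℝ => Real.exp (2 * π * y)) (2 * π) 0 := by
    simpa using ((hasDerivAt_id (0 : ℝ)).const_mul (2 * π)).exp
  have h2 := h.tendsto_slope_zero_right
  refine h2.congr fun y => ?_
  simp [div_eq_inv_mul]

lemma tendsto_one_sub_exp_div : Tendsto (fun y : ℝ => (1 - Real.exp (-(2 * π * y))) / y) (𝓝[>] 0)
    (𝓝 (2 * π)) := by
  have h : HasDerivAt (fun y : ℝ => 1 - Real.exp (-(2 * π * y))) (2 * π) 0 := by
    simpa using (((hasDerivAt_id (0 : ℝ)).const_mul (2 * π)).neg.exp).const_sub 1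
  have h2 := h.tendsto_slope_zero_right
  refine h2.congr fun y => ?_
  simp [div_eq_inv_mul]

lemma tendsto_sin_div (k : ℕ+) : Tendsto (fun y : ℝ => Real.sin (2 * π * k * y) / y) (𝓝[>] 0)
    (𝓝 (2 * π * k)) := by
  have h : HasDerivAt (fun y : ℝ => Real.sin (2 * π * k * y)) (2 * π * k) 0 := by
    simpa using ((hasDerivAt_id (0 : ℝ)).const_mul (2 * π * k)).sin
  have h2 := h.tendsto_slope_zero_right
  refine h2.congr fun y => ?_
  simp [div_eq_inv_mul]

/-- Rationalizing 1/(n + ik) and keeping the real part produces the inner series of the final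
formula. -/
lemma lerch_zero_re (k : ℕ+) : (k : ℝ) ^ 2 * (-I * lerch k 0).re =
    -(k * ∑' n : ℕ+, (k : ℝ) ^ 2 / ((n : ℝ) * ((k : ℝ) ^ 2 + (n : ℝ) ^ 2))) := by
  have hs := (summable_lerch k le_rfl).mul_left (-I)
  rw [lerch, ← tsum_mul_left, re_tsum hs, ← tsum_mul_left, ← tsum_mul_left, ← tsum_neg]
  refine tsum_congr fun n => ?_
  have hn : (n : ℂ) ≠ 0 := by exact_mod_cast n.ne_zero
  have hD := pnat_add_pnat_mul_I_ne_zero k n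
  have hR : ((k : ℂ) ^ 2 + (n : ℂ) ^ 2) ≠ 0 := sq_add_pnat_sq_ne_zero (by simp) n
  have hn' := pnat_pos n
  have hk' := pnat_pos k
  have e : -I * ((Real.exp (-(2 * π * 0) * n) : ℂ) * (1 / ((n : ℂ) * (n + k * I)))) =
      ((-(k / (n * ((k : ℝ) ^ 2 + (n : ℝ) ^ 2))) : ℝ) : ℂ) +
      ((-(1 / ((k : ℝ) ^ 2 + (n : ℝ) ^ 2)) : ℝ) : ℂ) * I := by
    have hf : (k : ℂ) ^ 2 + (n : ℂ) ^ 2 = (n + k * I) * (n - k * I) := by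
      ring_nf; rw [I_sq]; ring
    have hE : (n : ℂ) - k * I ≠ 0 := fun h0 => hR (by rw [hf, h0, mul_zero])
    simp only [mul_zero, neg_zero, zero_mul, Real.exp_zero, ofReal_one, one_mul]
    push_cast
    rw [hf]
    generalize hd : (n : ℂ) + k * I = D at hD ⊢
    generalize he : (n : ℂ) - k * I = E at hE ⊢
    field_simp
    rw [← he]
    ring_nf
    rw [I_sq]
    ring
  rw [e, add_re, re_ofReal_mul, ofReal_re, I_re]
  ring

lemma tendsto_rowTerm (k : ℕ+) : Tendsto (rowTerm k) (𝓝[>] 0)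
    (𝓝 (k * (1 - Real.log (2 * π)
      - ∑' n : ℕ+, (k : ℝ) ^ 2 / ((n : ℝ) * ((k : ℝ) ^ 2 + (n : ℝ) ^ 2))))) := by
  have hpi := Real.pi_pos
  have h1 : Tendsto (fun y => Real.sin (2 * π * k * y) * (1 / (Real.exp (2 * π * y) - 1)))
      (𝓝[>] 0) (𝓝 k) := by
    have := (tendsto_sin_div k).div tendsto_exp_sub_one_div (by positivity)
    rw [show 2 * π * (k : ℝ) / (2 * π) = k by field_simp] at this
    refine this.congr' ?_
    filter_upwards [eventually_small one_pos] with y hy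
    have h0 := hy.1
    have h2 : Real.exp (2 * π * y) - 1 ≠ 0 := by
      have := Real.add_one_le_exp (2 * π * y)
      have : 0 < 2 * π * y := by positivity
      linarith
    simp only [Pi.div_apply]
    field_simp
  have h2 : Tendsto (fun y => Real.log y - Real.log (1 - Real.exp (-(2 * π * y)))) (𝓝[>] 0)
      (𝓝 (-Real.log (2 * π))) := by
    refine (tendsto_one_sub_exp_div.log Real.two_pi_pos.ne').neg.congr' ?_
    filter_upwards [eventually_small (by norm_num : (0 : ℝ) < 1 / 2)] with y hy
    obtain ⟨h3, -⟩ := one_sub_exp_bounds hy.1 hy.2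
    rw [Real.log_div (by linarith [hy.1]) hy.1.ne']
    ring
  have h3 : Tendsto (fun y => (1 - Real.cos (2 * π * k * y)) *
      Real.log (1 - Real.exp (-(2 * π * y)))) (𝓝[>] 0) (𝓝 0) := by
    have hb : Tendsto (fun y : ℝ => 2 * π ^ 2 * (k : ℝ) ^ 2 * y) (𝓝[>] 0) (𝓝 0) := by
      have : Continuous fun y : ℝ => 2 * π ^ 2 * (k : ℝ) ^ 2 * y := by fun_prop
      have := this.tendsto 0
      rw [mul_zero] at this
      exact this.mono_left nhdsWithin_le_nhds
    refine squeeze_zero_norm' ?_ hb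
    filter_upwards [eventually_small (by norm_num : (0 : ℝ) < 1 / 2)] with y hy
    exact abs_one_sub_cos_mul_log_le k hy.1 hy.2
  have h4 : Tendsto (fun y : ℝ => (exp (-(2 * π * k * y * I)) * (-I * lerch k y)).re) (𝓝[>] 0)
      (𝓝 (-I * lerch k 0).re) := by
    have hc : Continuous fun y : ℝ => exp (-(2 * π * k * y * I)) := by fun_prop
    have := (hc.tendsto 0).mono_left (nhdsWithin_le_nhds (s := Set.Ioi 0))
    simp only [ofReal_zero, mul_zero, zero_mul, neg_zero, exp_zero] at this
    have h5 := this.mul ((tendsto_lerch k).const_mul (-I))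
    rw [one_mul] at h5
    exact (continuous_re.tendsto _).comp h5
  have h5 := (h1.add ((h2.add h3).const_mul (k : ℝ))).add (h4.const_mul ((k : ℝ) ^ 2))
  rw [lerch_zero_re] at h5
  convert! h5 using 2
  · rw [rowTerm, rowTerm_log_eq]
  · ring

lemma tendsto_expSide_above (m : ℕ+) :
    Tendsto (fun y => (expSide (above m y)).re - boseDeriv m * Real.log y) (𝓝[>] 0)
      (𝓝 (∑' k : ℕ+, 2 * π * Real.exp (-(2 * π * k * m)) * (k * (1 - Real.log (2 * π)
      - ∑' n : ℕ+, (k : ℝ) ^ 2 / ((n : ℝ) * ((k : ℝ) ^ 2 + (n : ℝ) ^ 2)))))) := by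
  have hpi := Real.pi_pos
  set K := 1 + 2 * π + 2 * π ^ 2 + π ^ 2 / 6 with hK
  have hs := (summable_pow_mul_exp 3 Real.two_pi_pos).mul_left (2 * π * K)
  have hbound : ∀ y, 0 < y ∧ y ≤ 1 / 2 → ∀ k : ℕ+,
      ‖2 * π * Real.exp (-(2 * π * k * m)) * rowTerm k y‖ ≤
        2 * π * K * ((k : ℝ) ^ 3 * Real.exp (-(2 * π) * k)) := by
    intro y hy k
    have hk := pnat_pos k
    have hm := one_le_pnat m
    rw [norm_mul, Real.norm_of_nonneg (by positivity), Real.norm_eq_abs]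
    have h1 : Real.exp (-(2 * π * k * m)) ≤ Real.exp (-(2 * π) * k) := by
      rw [Real.exp_le_exp, neg_mul, neg_le_neg_iff]
      exact le_mul_of_one_le_right (by positivity) hm
    calc _ ≤ 2 * π * Real.exp (-(2 * π) * k) * (K * (k : ℝ) ^ 3) := by
          gcongr
          exact abs_rowTerm_le k hy.1 hy.2
      _ = _ := by ring
  have h : Tendsto (fun y => ∑' k : ℕ+, 2 * π * Real.exp (-(2 * π * k * m)) * rowTerm k y) (𝓝[>] 0)
      (𝓝 (∑' k : ℕ+, 2 * π * Real.exp (-(2 * π * k * m)) * (k * (1 - Real.log (2 * π)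
      - ∑' n : ℕ+, (k : ℝ) ^ 2 / ((n : ℝ) * ((k : ℝ) ^ 2 + (n : ℝ) ^ 2)))))) := by
    refine tendsto_tsum_of_dominated_convergence hs (fun k => (tendsto_rowTerm k).const_mul _) ?_
    filter_upwards [eventually_small (by norm_num : (0 : ℝ) < 1 / 2)] with y hy
    exact hbound y hy
  refine h.congr' ?_
  filter_upwards [eventually_small (by norm_num : (0 : ℝ) < 1 / 2)] with y hy
  have hsum := summable_expTerm (z := above m y) (by simp) (by simpa using hy.1)
  have h1 := hasSum_re (hsum.hasSum.prod_fiberwise fun k => hasSum_expTerm_row m k hy.1)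
  have h2 : HasSum (fun k : ℕ+ => 2 * π * Real.exp (-(2 * π * k * m)) *
      (rowTerm k y - k * Real.log y)) (expSide (above m y)).re := by
    convert! h1 using 1
    ext k
    rw [← expTerm_row_re, ← re_ofReal_mul]
    push_cast
    rfl
  -- The logarithms removed from the rows add up to -2π log y times the sum of k e^{-2πkm}, that is
  -- h'(m) log y, the same singularity as on the other side.
  have h3 := h2.add ((hasSum_mul_exp_neg m).mul_right (2 * π * Real.log y))
  refine HasSum.tsum_eq ?_
  convert! h3 using 1
  · ext k
    ring
  · field_simp
    ring

/-! ### Convergence of the final series and assembly of the formula -/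

lemma pnat_sq_sub_sq_abs {m n : ℕ+} (h : n ≠ m) : 1 ≤ |(n : ℝ) ^ 2 - (m : ℝ) ^ 2| := by
  have h1 : ((n : ℤ) ^ 2 - (m : ℤ) ^ 2) ≠ 0 := by
    rw [sub_ne_zero]
    intro h2
    have h3 := (sq_eq_sq₀ (by positivity) (by positivity)).1 h2
    exact h (by exact_mod_cast h3)
  exact_mod_cast Int.one_le_abs h1

lemma summable_bose_rational (m : ℕ+) : Summable fun n => bose n * rationalLimit m n := by
  refine Summable.of_norm_bounded ((summable_pow_mul_bose 1).mul_left 2) fun n => ?_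
  have hn := one_le_pnat n
  have hm := one_le_pnat m
  rw [norm_mul, Real.norm_of_nonneg (bose_pos n).le, pow_one]
  have h : ‖rationalLimit m n‖ ≤ 2 * n := by
    rw [rationalLimit]
    split_ifs with hnm
    · rw [Real.norm_of_nonneg (by positivity)]
      have : 1 / (2 * (m : ℝ)) ≤ 1 := by
        rw [div_le_one (by positivity)]; linarith
      linarith
    · rw [norm_div, Real.norm_of_nonneg (by positivity)]
      exact div_le_self (by positivity) (pnat_sq_sub_sq_abs hnm)
  calc _ ≤ bose n * (2 * n) := mul_le_mul_of_nonneg_left h (bose_pos n).le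
    _ = _ := by ring

lemma summable_boseDeriv_logLimit (m : ℕ+) : Summable fun n => boseDeriv n * logLimit m n := by
  refine Summable.of_norm_bounded (((summable_pow_mul_abs_boseDeriv 4).add
    ((summable_pow_mul_abs_boseDeriv 0).mul_left (4 * (m : ℝ) ^ 4)))) fun n => ?_
  have hn := one_le_pnat n
  have hm := one_le_pnat m
  have hm4 : (m : ℝ) ^ 3 ≤ (m : ℝ) ^ 4 := pow_le_pow_right₀ hm (by norm_num)
  have hm3 : 1 ≤ (m : ℝ) ^ 3 := one_le_pow₀ hm
  have hn4 : 1 ≤ (n : ℝ) ^ 4 := one_le_pow₀ hn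
  have h : ‖logLimit m n‖ ≤ (n : ℝ) ^ 4 + 4 * (m : ℝ) ^ 4 := by
    rw [logLimit]
    split_ifs with hnm
    · rw [Real.norm_of_nonneg (Real.log_nonneg (by linarith))]
      have := Real.log_le_sub_one_of_pos (by linarith : 0 < 4 * (m : ℝ) ^ 3)
      linarith
    · have h1 : 1 ≤ |(n : ℝ) ^ 4 - (m : ℝ) ^ 4| := by
        rw [show (n : ℝ) ^ 4 - (m : ℝ) ^ 4 =
          ((n : ℝ) ^ 2 - (m : ℝ) ^ 2) * ((n : ℝ) ^ 2 + (m : ℝ) ^ 2) by ring, abs_mul,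
          abs_of_pos (by positivity : 0 < (n : ℝ) ^ 2 + (m : ℝ) ^ 2)]
        have := pnat_sq_sub_sq_abs hnm
        nlinarith
      rw [Real.norm_of_nonneg (Real.log_nonneg h1)]
      have h2 := Real.log_le_sub_one_of_pos (by linarith : 0 < |(n : ℝ) ^ 4 - (m : ℝ) ^ 4|)
      have h3 := abs_sub (a := (n : ℝ) ^ 4) (b := (m : ℝ) ^ 4)
      rw [abs_of_nonneg (by positivity : 0 ≤ (n : ℝ) ^ 4),
        abs_of_nonneg (by positivity : 0 ≤ (m : ℝ) ^ 4)] at h3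
      linarith
  rw [norm_mul, Real.norm_eq_abs]
  calc _ ≤ |boseDeriv n| * ((n : ℝ) ^ 4 + 4 * (m : ℝ) ^ 4) := by gcongr
    _ = _ := by ring

lemma tsum_eq_add_tsum_ne {f : ℕ+ → ℝ} (hf : Summable f) (m : ℕ+) :
    ∑' n, f n = f m + ∑' n : {n : ℕ+ // n ≠ m}, f n := by
  have h := hf.tsum_subtype_add_tsum_subtype_compl {m}
  rw [tsum_singleton] at h
  exact h.symm

lemma norm_inner_term_le (k n : ℕ+) :
    ‖(k : ℝ) ^ 2 / ((n : ℝ) * ((k : ℝ) ^ 2 + (n : ℝ) ^ 2))‖ ≤ (k : ℝ) ^ 2 * (1 / (n : ℝ) ^ 2) := by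
  have hn := one_le_pnat n
  have hk := one_le_pnat k
  rw [Real.norm_of_nonneg (by positivity), mul_one_div]
  gcongr
  nlinarith [sq_nonneg (k : ℝ), sq_nonneg (n : ℝ)]

lemma summable_inner (k : ℕ+) :
    Summable fun n : ℕ+ => (k : ℝ) ^ 2 / ((n : ℝ) * ((k : ℝ) ^ 2 + (n : ℝ) ^ 2)) :=
  Summable.of_norm_bounded (summable_inv_pnat_sq.mul_left _) (norm_inner_term_le k)

lemma summable_outer (m : ℕ+) : Summable fun k : ℕ+ =>
    (k : ℝ) * Real.exp (-(2 * π * k * m)) *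
      ∑' n : ℕ+, (k : ℝ) ^ 2 / ((n : ℝ) * ((k : ℝ) ^ 2 + (n : ℝ) ^ 2)) := by
  refine Summable.of_norm_bounded
    ((summable_pow_mul_exp 3 Real.two_pi_pos).mul_right (π ^ 2 / 6)) fun k => ?_
  have hk := pnat_pos k
  have hm := one_le_pnat m
  have hpi := Real.pi_pos
  have h1 : ‖∑' n : ℕ+, (k : ℝ) ^ 2 / ((n : ℝ) * ((k : ℝ) ^ 2 + (n : ℝ) ^ 2))‖ ≤
      (k : ℝ) ^ 2 * (π ^ 2 / 6) :=
    tsum_of_norm_bounded (hasSum_pnat_inv_sq.mul_left _) (norm_inner_term_le k)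
  have h2 : Real.exp (-(2 * π * k * m)) ≤ Real.exp (-(2 * π) * k) := by
    rw [Real.exp_le_exp, neg_mul, neg_le_neg_iff]
    exact le_mul_of_one_le_right (by positivity) hm
  rw [norm_mul, Real.norm_of_nonneg (by positivity)]
  calc _ ≤ k * Real.exp (-(2 * π) * k) * ((k : ℝ) ^ 2 * (π ^ 2 / 6)) := by gcongr
    _ = _ := by ring

/-- Uniqueness of the limit as y → 0+ of the regularized real part of `polarSide`, computed directly
and through `expSide`. The terms n = m are still inside the sums. -/
theorem harmonic_sub_eulerMascheroni (m : ℕ+) :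
    -Real.eulerMascheroniConstant + ∑ j ∈ Finset.Icc 1 (m : ℕ), 1 / (j : ℝ) =
      -(1 / (4 * π * (m : ℝ) ^ 2)) + 1 / (2 * (m : ℝ)) + π / 3 * Real.log m
        + ∑' n, bose n * rationalLimit m n + ∑' n, boseDeriv n * logLimit m n
        + boseDeriv m * (1 - Real.log (2 * π))
        + 2 * π * ∑' k : ℕ+, (k : ℝ) * Real.exp (-(2 * π * k * m)) *
          ∑' n : ℕ+, (k : ℝ) ^ 2 / ((n : ℝ) * ((k : ℝ) ^ 2 + (n : ℝ) ^ 2)) := by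
  have h1 := tendsto_polarSide_above m
  have h2 : Tendsto (fun y => (polarSide (above m y)).re - boseDeriv m * Real.log y) (𝓝[>] 0) _ :=
    ((tendsto_expSide_above m).sub_const Real.eulerMascheroniConstant).congr' (by
      filter_upwards [eventually_small one_pos] with y hy
      rw [polarSide_re_eq (z := above m y) ⟨by rw [above_re]; linarith [one_le_pnat m],
        by simpa using hy.1⟩]
      ring)
  have h3 := tendsto_nhds_unique h1 h2
  have h4 := (((hasSum_mul_exp_neg m).mul_left (2 * π * (1 - Real.log (2 * π)))).sub
    ((summable_outer m).hasSum.mul_left (2 * π))).tsum_eq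
  have h5 : 2 * π * (1 - Real.log (2 * π)) * (-boseDeriv m / (2 * π)) =
      -(boseDeriv m * (1 - Real.log (2 * π))) := by
    have := Real.pi_ne_zero
    field_simp
  rw [h5] at h4
  have h6 : ∑' k : ℕ+, 2 * π * Real.exp (-(2 * π * k * m)) * (k * (1 - Real.log (2 * π)
      - ∑' n : ℕ+, (k : ℝ) ^ 2 / ((n : ℝ) * ((k : ℝ) ^ 2 + (n : ℝ) ^ 2)))) = _ :=
    (tsum_congr fun k => by ring).trans h4
  rw [h6] at h3
  linarith

end HarmonicBose

open HarmonicBose in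
theorem mainTheorem2 (m : ℕ+) :
    -- all the series that occur converge (absolutely)
    Summable (fun k : {k : ℕ+ // k ≠ m} =>
      2 * ((k : ℕ+) : ℝ) /
        ((Real.exp (2 * Real.pi * ((k : ℕ+) : ℝ)) - 1) * (((k : ℕ+) : ℝ) ^ 2 - (m : ℝ) ^ 2))) ∧
    Summable (fun k : {k : ℕ+ // k ≠ m} =>
      Real.log |((k : ℕ+) : ℝ) ^ 4 - (m : ℝ) ^ 4| / Real.sinh (Real.pi * ((k : ℕ+) : ℝ)) ^ 2) ∧
    (∀ k : ℕ+, Summable (fun n : ℕ+ => (k : ℝ) ^ 2 / ((n : ℝ) * ((k : ℝ) ^ 2 + (n : ℝ) ^ 2)))) ∧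
    Summable (fun k : ℕ+ =>
      (k : ℝ) * Real.exp (-2 * Real.pi * (k : ℝ) * (m : ℝ)) *
        ∑' n : ℕ+, (k : ℝ) ^ 2 / ((n : ℝ) * ((k : ℝ) ^ 2 + (n : ℝ) ^ 2))) ∧
    -- the formula
    -Real.eulerMascheroniConstant + ∑ j ∈ Finset.Icc 1 (m : ℕ), 1 / (j : ℝ) =
      Real.pi / 3 * Real.log (m : ℝ) + 1 / (2 * (m : ℝ)) - 1 / (4 * Real.pi * (m : ℝ) ^ 2)
      + ∑' k : {k : ℕ+ // k ≠ m},
          2 * ((k : ℕ+) : ℝ) /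
            ((Real.exp (2 * Real.pi * ((k : ℕ+) : ℝ)) - 1) *
              (((k : ℕ+) : ℝ) ^ 2 - (m : ℝ) ^ 2))
      + Real.pi / 2 *
          ((Real.log Real.pi - Real.log (2 * (m : ℝ) ^ 3) - 1) /
            Real.sinh (Real.pi * (m : ℝ)) ^ 2)
      - Real.pi / 2 *
          ∑' k : {k : ℕ+ // k ≠ m},
            Real.log |((k : ℕ+) : ℝ) ^ 4 - (m : ℝ) ^ 4| /
              Real.sinh (Real.pi * ((k : ℕ+) : ℝ)) ^ 2
      + 1 / (2 * (m : ℝ) * (Real.exp (2 * Real.pi * (m : ℝ)) - 1))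
      + 2 * Real.pi *
          ∑' k : ℕ+,
            (k : ℝ) * Real.exp (-2 * Real.pi * (k : ℝ) * (m : ℝ)) *
              ∑' n : ℕ+, (k : ℝ) ^ 2 / ((n : ℝ) * ((k : ℝ) ^ 2 + (n : ℝ) ^ 2)) := by
  have hpi := Real.pi_pos
  have hm := pnat_pos m
  have hexp : ∀ k : ℕ+, Real.exp (-2 * Real.pi * (k : ℝ) * (m : ℝ)) =
      Real.exp (-(2 * Real.pi * k * m)) := fun k => by congr 1; ring
  have hrat : ∀ k : {k : ℕ+ // k ≠ m}, 2 * ((k : ℕ+) : ℝ) /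
      ((Real.exp (2 * Real.pi * ((k : ℕ+) : ℝ)) - 1) * (((k : ℕ+) : ℝ) ^ 2 - (m : ℝ) ^ 2)) =
      bose k * rationalLimit m k := fun k => by
    rw [bose, rationalLimit, if_neg k.2, div_mul_div_comm, one_mul]
  have hlog : ∀ k : {k : ℕ+ // k ≠ m},
      Real.log |((k : ℕ+) : ℝ) ^ 4 - (m : ℝ) ^ 4| / Real.sinh (Real.pi * ((k : ℕ+) : ℝ)) ^ 2 =
      -(2 / Real.pi) * (boseDeriv k * logLimit m k) := fun k => by
    rw [boseDeriv, logLimit, if_neg k.2]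
    field_simp
  have hr := summable_bose_rational m
  have hl := summable_boseDeriv_logLimit m
  simp only [hexp, hrat, hlog]
  refine ⟨hr.subtype {k | k ≠ m}, (hl.subtype {k | k ≠ m}).mul_left _, summable_inner,
    summable_outer m, ?_⟩
  rw [harmonic_sub_eulerMascheroni, tsum_eq_add_tsum_ne hr m, tsum_eq_add_tsum_ne hl m,
    tsum_mul_left]
  have e1 : bose m * rationalLimit m m =
      1 / (2 * (m : ℝ) * (Real.exp (2 * Real.pi * (m : ℝ)) - 1)) := by
    rw [bose, rationalLimit, if_pos rfl, div_mul_div_comm, one_mul, mul_comm]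
  -- The logarithmic term n = m, with 4m³, merges with the constant 1 - log(2π) from the exponential
  -- side, leaving log π - log(2m³) - 1 after the sign of h'(m) is taken out.
  have e2 : boseDeriv m * logLimit m m + boseDeriv m * (1 - Real.log (2 * Real.pi)) =
      Real.pi / 2 * ((Real.log Real.pi - Real.log (2 * (m : ℝ) ^ 3) - 1) /
            Real.sinh (Real.pi * (m : ℝ)) ^ 2) := by
    rw [boseDeriv, logLimit, if_pos rfl, Real.log_mul two_ne_zero hpi.ne',
      show 4 * (m : ℝ) ^ 3 = 2 * (2 * (m : ℝ) ^ 3) by ring,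
      Real.log_mul two_ne_zero (by positivity)]
    ring
  have e3 : Real.pi / 2 * (-(2 / Real.pi) * ∑' k : {k : ℕ+ // k ≠ m}, boseDeriv k * logLimit m k) =
      -∑' k : {k : ℕ+ // k ≠ m}, boseDeriv k * logLimit m k := by
    field_simp
  rw [e3, ← e1, ← e2]
  ring
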